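/- Let $N\ge 0$ be an integer and $\gamma,\delta\in\mathbb C$. Write $(a)_k=a(a+1)\cdots(a+k-1)$ and $\lambda(x)=x(x+\gamma+\delta+1)$. For every $n\ge 0$ let $R_n(\lambda(x);\gamma,\delta,N)$ be the (monic) dual Hahn polynomial of degree $n$ in $\lambda(x)$, $$R_n(\lambda(x);\gamma,\delta,N)=\sum_{k=0}^n\frac{(-n)_k(-x)_k(x+\gamma+\delta+1)_k}{k!}\,(\gamma+1+k)_{n-k}\,(-N+k)_{n-k},$$ which equals $(\gamma+1)_n(-N)_n\,{}_3F_2\!\left({-n,\,-x,\,x+\gamma+\delta+1\atop \gamma+1,\,-N}\Big|1\right)$ whenever the latter is defined, and let $$S_n(x^2;a,b,c)=(-1)^n\sum_{k=0}^n\frac{(-n)_k(a+ix)_k(a-ix)_k}{k!}\,(a+b+k)_{n-k}\,(a+c+k)_{n-k}$$ be the monic continuous dual Hahn polynomials. (1) Factorization. For every $n>N$ and every $x\in\mathbb C$, $$R_n(\lambda(x);\gamma,\delta,N)=R_{N+1}(\lambda(x);\gamma,\delta,N)\,(-1)^{n-N-1}\,S_{n-N-1}\!\left(\Big(ix+i\tfrac{\gamma+\delta+1}{2}\Big)^2;\,N+\tfrac{\gamma+\delta+3}{2},\,\tfrac{-\gamma-\delta+1}{2},\,\tfrac{\gamma-\delta+1}{2}\right).$$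 (2) $\Delta$-Sobolev orthogonality. For a function $f$ of $x$ put $D_kf(x)=\dfrac{f(x+1)-f(x)}{\lambda_k(x+1)-\lambda_k(x)}$ with $\lambda_k(x)=x(x+\gamma+\delta+k+1)$, and let $(\Delta/\Delta\lambda)^{N+1}=D_N\cdots D_1D_0$. Let $$\nu(z)=\frac{\Gamma(a+iz)\Gamma(b+iz)\Gamma(c+iz)}{\Gamma(2iz)},\qquad a=1+\tfrac{\gamma+\delta+N}{2},\quad b=1+\tfrac{\gamma-\delta+N}{2},\quad c=-\tfrac{\gamma+\delta+N}{2},$$ $$w(z)=\nu\big(i(z+1+\tfrac{\gamma+\delta+N}{2})\big)\,\nu\big(-i(z+1+\tfrac{\gamma+\delta+N}{2})\big).$$ Assume that the increasing sequences $k,\ -\gamma-\delta-N-1+k,\ -\delta+k$ ($k\ge 0$) are disjoint from the decreasing sequences $-\gamma-\delta-N-2-k,\ -1-k,\ -\gamma-N-2-k$ ($k\ge0$), and that the denominators $(x+\gamma+\delta+1)_{N+1}$ and $(\delta+1)_x$ in the sum below do not vanish for $x=0,\dots,N$. Then there is a contour $C$, namely the imaginary axis or a parallel of it, oriented upwards and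 deformed on a bounded part, with the increasing sequences on its right and the decreasing sequences on its left; and for every such (piecewise continuously differentiable) contour $C$ the following holds. For all polynomials $p,q$, with $P(x)=p(\lambda(x))$ and $Q(x)=q(\lambda(x))$, the integral in $$\langle p,q\rangle_S=\sum_{x=0}^{N}P(x)Q(x)\,\frac{(2x+\gamma+\delta+1)(\gamma+1)_x(-N)_x}{(-1)^x(x+\gamma+\delta+1)_{N+1}(\delta+1)_x\,x!}+\int_C\Big(\big(\tfrac{\Delta}{\Delta\lambda}\big)^{N+1}P\Big)(z)\,\Big(\big(\tfrac{\Delta}{\Delta\lambda}\big)^{N+1}Q\Big)(z)\,w(z)\,dz$$ converges absolutely, and $$\langle R_m,R_n\rangle_S=0\qquad\text{for all } m\ne n .$$ If moreover $\gamma\notin\{-1,-2,\dots,-N\}$, then $\langle R_n,R_n\rangle_S\neq 0$ for every $n\ge 0$. -/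

import Mathlib

open MeasureTheory

noncomputable section

namespace DualHahn

/-! ### Polynomials -/

/-- The Pochhammer symbol `(a)_n = a (a + 1) ⋯ (a + n - 1)`. -/
def poch (a : ℂ) (n : ℕ) : ℂ := (ascPochhammer ℂ n).eval a

/-- The quadratic lattice `λ(x) = x (x + γ + δ + 1)`. -/
def lat (γ δ x : ℂ) : ℂ := x * (x + γ + δ + 1)

/-- The monic dual Hahn polynomial of degree `n` (for every `n`), as a polynomial in `λ`:
`∑_{k ≤ n} (-n)_k / k! * (γ+1+k)_{n-k} * (-N+k)_{n-k} * ∏_{j < k} (j (j + γ + δ + 1) - λ)`.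
On the lattice the product is `(-x)_k (x + γ + δ + 1)_k`, see `dualHahn_eval_lat`. -/
def dualHahn (γ δ : ℂ) (N n : ℕ) : Polynomial ℂ :=
  ∑ k ∈ Finset.range (n + 1),
    Polynomial.C (poch (-(n : ℂ)) k / (k.factorial : ℂ)
      * poch (γ + 1 + k) (n - k) * poch (-(N : ℂ) + k) (n - k))
    * ∏ j ∈ Finset.range k, (Polynomial.C ((j : ℂ) * (j + γ + δ + 1)) - Polynomial.X)

/-- The monic continuous dual Hahn polynomial of degree `n`, as a polynomial in `x ^ 2`:
`(-1)^n * ∑_{k ≤ n} (-n)_k / k! * (a+b+k)_{n-k} * (a+c+k)_{n-k} * ∏_{j < k} ((a + j)^2 + x^2)`.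
The product is `(a + i x)_k (a - i x)_k`, see `contDualHahn_eval_sq`. -/
def contDualHahn (a b c : ℂ) (n : ℕ) : Polynomial ℂ :=
  Polynomial.C ((-1) ^ n) * ∑ k ∈ Finset.range (n + 1),
    Polynomial.C (poch (-(n : ℂ)) k / (k.factorial : ℂ)
      * poch (a + b + k) (n - k) * poch (a + c + k) (n - k))
    * ∏ j ∈ Finset.range k, (Polynomial.C ((a + j) ^ 2) + Polynomial.X)

theorem poch_eq_prod (a : ℂ) (n : ℕ) : poch a n = ∏ j ∈ Finset.range n, (a + j) := by
  induction n with
  | zero => simp [poch]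
  | succ n ih =>
    rw [Finset.prod_range_succ, ← ih, poch, poch, ascPochhammer_succ_eval]

theorem poch_split (a : ℂ) {k n : ℕ} (h : k ≤ n) :
    poch a k * poch (a + k) (n - k) = poch a n := by
  obtain ⟨m, rfl⟩ := Nat.exists_eq_add_of_le h
  simp only [poch_eq_prod, Nat.add_sub_cancel_left, Finset.prod_range_add, Nat.cast_add, add_assoc]

theorem dualHahn_eval_lat (γ δ x : ℂ) (N n : ℕ) :
    (dualHahn γ δ N n).eval (lat γ δ x) =
      ∑ k ∈ Finset.range (n + 1), poch (-(n : ℂ)) k / (k.factorial : ℂ)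
        * poch (γ + 1 + k) (n - k) * poch (-(N : ℂ) + k) (n - k)
        * (poch (-x) k * poch (x + γ + δ + 1) k) := by
  simp only [dualHahn, Polynomial.eval_finsetSum, Polynomial.eval_mul, Polynomial.eval_C,
    Polynomial.eval_prod, Polynomial.eval_sub, Polynomial.eval_X]
  refine Finset.sum_congr rfl fun k _ => ?_
  congr 1
  rw [poch_eq_prod (-x), poch_eq_prod (x + γ + δ + 1), ← Finset.prod_mul_distrib]
  refine Finset.prod_congr rfl fun j _ => ?_
  rw [lat]; ring

theorem contDualHahn_eval_sq (a b c x : ℂ) (n : ℕ) :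
    (contDualHahn a b c n).eval (x ^ 2) =
      (-1) ^ n * ∑ k ∈ Finset.range (n + 1), poch (-(n : ℂ)) k / (k.factorial : ℂ)
        * poch (a + b + k) (n - k) * poch (a + c + k) (n - k)
        * (poch (a + Complex.I * x) k * poch (a - Complex.I * x) k) := by
  simp only [contDualHahn, Polynomial.eval_finsetSum, Polynomial.eval_mul, Polynomial.eval_C,
    Polynomial.eval_prod, Polynomial.eval_add, Polynomial.eval_X]
  congr 1
  refine Finset.sum_congr rfl fun k _ => ?_
  congr 1
  rw [poch_eq_prod (a + Complex.I * x), poch_eq_prod (a - Complex.I * x),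
    ← Finset.prod_mul_distrib]
  refine Finset.prod_congr rfl fun j _ => ?_
  linear_combination (x ^ 2) * Complex.I_sq

/-- When the hypergeometric series is defined, `dualHahn` is
`(γ+1, -N)_n ₃F₂(-n, -x, x+γ+δ+1; γ+1, -N | 1)`. -/
theorem dualHahn_eval_lat_hypergeometric (γ δ x : ℂ) (N n : ℕ)
    (h : ∀ k ≤ n, poch (γ + 1) k ≠ 0) (h' : ∀ k ≤ n, poch (-(N : ℂ)) k ≠ 0) :
    (dualHahn γ δ N n).eval (lat γ δ x) =
      poch (γ + 1) n * poch (-(N : ℂ)) n *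
        ∑ k ∈ Finset.range (n + 1),
          poch (-(n : ℂ)) k * poch (-x) k * poch (x + γ + δ + 1) k
            / (poch (γ + 1) k * poch (-(N : ℂ)) k * (k.factorial : ℂ)) := by
  rw [dualHahn_eval_lat, Finset.mul_sum]
  refine Finset.sum_congr rfl fun k hk => ?_
  have hk : k ≤ n := Nat.lt_succ_iff.mp (Finset.mem_range.mp hk)
  have h1 := h k hk
  have h2 := h' k hk
  have h3 : (k.factorial : ℂ) ≠ 0 := by exact_mod_cast k.factorial_ne_zero
  rw [← poch_split (γ + 1) hk, ← poch_split (-(N : ℂ)) hk]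
  field_simp

/-! ### Iterated divided differences on the quadratic lattice -/

/-- `(Δ/Δλ)^k f`, where `f` is a function of the lattice variable `x`. A polynomial in
`λ(x) = x (x + γ + δ + 1)` is sent by `Δ/Δλ` to a polynomial in `x (x + γ + δ + 2)`, so the
`(k+1)`-st difference is taken with respect to `λ_k(x) = x (x + γ + δ + k + 1)`, which up to an
additive constant is `λ(x + k/2)`. -/
def latDiff (γ δ : ℂ) : ℕ → (ℂ → ℂ) → ℂ → ℂ
  | 0, f => f
  | k + 1, f => fun x =>
      (latDiff γ δ k f (x + 1) - latDiff γ δ k f x)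
        / (lat (γ + k) δ (x + 1) - lat (γ + k) δ x)

/-! ### The bilinear form -/

/-- The `x`-th mass of the discrete part. -/
def discreteWeight (γ δ : ℂ) (N x : ℕ) : ℂ :=
  (2 * x + γ + δ + 1) * poch (γ + 1) x * poch (-(N : ℂ)) x
    / ((-1) ^ x * poch (x + γ + δ + 1) (N + 1) * poch (δ + 1) x * poch 1 x)

/-- `ν(z; a, b, c) = Γ(a + iz) Γ(b + iz) Γ(c + iz) / Γ(2iz)`. -/
def nu (a b c z : ℂ) : ℂ :=
  Complex.Gamma (a + Complex.I * z) * Complex.Gamma (b + Complex.I * z)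
    * Complex.Gamma (c + Complex.I * z) / Complex.Gamma (2 * z * Complex.I)

/-- The continuous dual Hahn weight in the lattice variable `z`: with
`u = i (z + 1 + (γ + δ + N) / 2)` it is `ν(u) ν(-u)`. -/
def contWeight (γ δ : ℂ) (N : ℕ) (z : ℂ) : ℂ :=
  nu (1 + (γ + δ + N) / 2) (1 + (γ - δ + N) / 2) (-(γ + δ + N) / 2)
      (Complex.I * (z + 1 + (γ + δ + N) / 2))
    * nu (1 + (γ + δ + N) / 2) (1 + (γ - δ + N) / 2) (-(γ + δ + N) / 2)
      (-(Complex.I * (z + 1 + (γ + δ + N) / 2)))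

/-- The increasing sequences of poles of the continuous weight. -/
def incPoles (γ δ : ℂ) (N : ℕ) : Set ℂ :=
  {z | ∃ k : ℕ, z = k ∨ z = -γ - δ - N - 1 + k ∨ z = -δ + k}

/-- The decreasing sequences of poles of the continuous weight. -/
def decPoles (γ δ : ℂ) (N : ℕ) : Set ℂ :=
  {z | ∃ k : ℕ, z = -γ - δ - N - 2 - k ∨ z = -1 - k ∨ z = -γ - N - 2 - k}

/-- `C : ℝ → ℂ` is the imaginary axis (or a parallel of it), oriented upwards and deformed on a
bounded part into a rectifiable curve which has all of `A` on its right and all of `B` on its left: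
off the curve, each point of `A` can be joined to the far right, each point of `B` to the far
left. -/
structure IsSeparatingContour (C : ℝ → ℂ) (A B : Set ℂ) : Prop where
  continuous : Continuous C
  /-- `C` is continuously differentiable, with a bounded derivative, off a finite set. -/
  smooth : ∃ F : Finset ℝ, ∀ t ∉ F, ContDiffAt ℝ 1 C t
  bounded : ∃ L : ℝ, ∀ t, ‖deriv C t‖ ≤ L
  vertical : ∃ σ T : ℝ, ∀ t : ℝ, T ≤ |t| → C t = σ + t * Complex.I
  right : ∀ p ∈ A, ∃ r₀ : ℝ, ∀ r : ℝ, r₀ ≤ r → JoinedIn (Set.range C)ᶜ p (r : ℂ)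
  left : ∀ p ∈ B, ∃ r₀ : ℝ, ∀ r : ℝ, r₀ ≤ r → JoinedIn (Set.range C)ᶜ p ((-r : ℝ) : ℂ)

/-- The integrand, pulled back to the parameter `t` of the contour `z = C t`, of
`∫_C ((Δ/Δλ)^{N+1} p) ((Δ/Δλ)^{N+1} q) w dz`, where `p` and `q` are polynomials in `λ`. -/
def contIntegrand (γ δ : ℂ) (N : ℕ) (C : ℝ → ℂ) (p q : Polynomial ℂ) (t : ℝ) : ℂ :=
  latDiff γ δ (N + 1) (fun x => p.eval (lat γ δ x)) (C t)
    * latDiff γ δ (N + 1) (fun x => q.eval (lat γ δ x)) (C t)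
    * contWeight γ δ N (C t) * deriv C t

/-- The `Δ`-Sobolev bilinear form on polynomials in `λ`. -/
def sobolevForm (γ δ : ℂ) (N : ℕ) (C : ℝ → ℂ) (p q : Polynomial ℂ) : ℂ :=
  (∑ x ∈ Finset.range (N + 1),
      p.eval (lat γ δ x) * q.eval (lat γ δ x) * discreteWeight γ δ N x)
    + ∫ t : ℝ, contIntegrand γ δ N C p q t

end DualHahn

end

noncomputable section

namespace DualHahn

/-! ### Algebra of Pochhammer symbols and of polynomials on quadratic lattices -/

section Algebraic

open Polynomial

/-! Orthogonality comes from one algebraic principle, applied once to the discrete sum and once to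
the contour integral. In the variable X = z(z+s) there are two bases, `latProd s s k` with values
(-z)_k (z+s)_k and `latProd s u l` with values (z+u)_l (u-s-z)_l. Suppose a linear functional L has
mixed moments K (u)_{k+l} (v)_k (w)_l. Expanding `hahnFamily s u v n` in the first basis and testing
it against the second leaves the n-th finite difference of a polynomial of degree l. This vanishes
for l < n, and l = n gives the norm K (u)_n (v)_n (w)_n n!.

The two parts of the form decouple. For n > N every coefficient of index k ≤ N in R_n contains a
zero factor, so R_n is divisible by R_{N+1} and vanishes at the nodes 0, …, N; this also gives the
factorization. For n ≤ N, R_n is killed by N+1 divided differences. These differences turn R_{N+1+m}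
into a nonzero multiple of `hahnFamily s u 1 m` with s = γ+δ+N+2 and u = γ+N+2.

Discrete moments (`discreteFunctional_moments`): they vanish for k+l > N, only the mass at x = k
survives for k+l = N, and a recursion between the two bases gives the rest.

Continuous moments (`integral_latProd_mul_contWeight`): by the reflection formula the weight is a
product of two Gamma functions, a linear factor and a sum of two cotangents. Multiplied by `latProd
s u l` it becomes an exact difference F(z+1) - F(z). Its integral over C is therefore a sum of
residues of F between C and C+1, at 0 and at 1-s; the separation of the pole sequences excludes all
others. Since the contour is arbitrary, sides are measured by the limits of the integral of 1/(z-p)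
along C: -πi for p on the right, πi for p on the left. -/

theorem poch_neg_natCast (n k : ℕ) : poch (-(n : ℂ)) k = (-1) ^ k * n.descFactorial k := by
  rw [poch, ascPochhammer_eval_neg_eq_descPochhammer, descPochhammer_eval_eq_descFactorial]

theorem poch_neg_natCast_div_factorial (n k : ℕ) :
    poch (-(n : ℂ)) k / (k.factorial : ℂ) = (-1) ^ k * n.choose k := by
  rw [poch_neg_natCast, Nat.descFactorial_eq_factorial_mul_choose]
  have : (k.factorial : ℂ) ≠ 0 := by exact_mod_cast k.factorial_ne_zero
  push_cast
  field_simp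

theorem poch_add (a : ℂ) (k l : ℕ) : poch a (k + l) = poch a k * poch (a + k) l := by
  rw [← poch_split a (Nat.le_add_right k l), Nat.add_sub_cancel_left]

theorem poch_zero (a : ℂ) : poch a 0 = 1 := by simp [poch_eq_prod]

theorem poch_succ (a : ℂ) (k : ℕ) : poch a (k + 1) = poch a k * (a + k) := by
  simp [poch_eq_prod, Finset.prod_range_succ]

theorem poch_succ_left (a : ℂ) (k : ℕ) : poch a (k + 1) = a * poch (a + 1) k := by
  rw [add_comm k 1, poch_add, poch_succ, poch_zero]; simp

theorem poch_ne_zero {a : ℂ} {n : ℕ} : poch a n ≠ 0 ↔ ∀ j < n, a + j ≠ 0 := by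
  simp [poch_eq_prod, Finset.prod_ne_zero_iff]

theorem poch_one (n : ℕ) : poch 1 n = n.factorial := by
  rw [poch, ascPochhammer_eval_one]

theorem poch_neg (a : ℂ) (n : ℕ) : poch (-a) n = (-1) ^ n * poch (a - n + 1) n := by
  rw [poch_eq_prod, poch_eq_prod, ← Finset.prod_range_reflect,
    show ((-1 : ℂ)) ^ n = ∏ _j ∈ Finset.range n, (-1 : ℂ) by simp, ← Finset.prod_mul_distrib]
  refine Finset.prod_congr rfl fun j hj => ?_
  have hj := Finset.mem_range.mp hj
  rw [Nat.cast_sub (by omega), Nat.cast_sub (by omega)]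
  push_cast; ring

/-- The polynomial in `X = z (z + s)` that equals `(z + u)_l (u - s - z)_l`. -/
def latProd (s u : ℂ) (l : ℕ) : ℂ[X] :=
  ∏ j ∈ Finset.range l, (C ((u + j) * (u + j - s)) - X)

theorem latProd_eval (s u z : ℂ) (l : ℕ) :
    (latProd s u l).eval (z * (z + s)) = poch (z + u) l * poch (u - s - z) l := by
  rw [latProd, eval_prod, poch_eq_prod, poch_eq_prod, ← Finset.prod_mul_distrib]
  refine Finset.prod_congr rfl fun j _ => ?_
  simp only [eval_sub, eval_C, eval_X]; ring

theorem latProd_succ (s u : ℂ) (l : ℕ) :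
    latProd s u (l + 1) = latProd s u l * (C ((u + l) * (u + l - s)) - X) := by
  simp [latProd, Finset.prod_range_succ]

/-- The next factors of the two products are linear in X with the same slope, so they differ by a
constant. This recursion drives both moment computations. -/
theorem latProd_succ_mul (s u : ℂ) (k l : ℕ) :
    latProd s s (k + 1) * latProd s u l = latProd s s k * latProd s u (l + 1)
      + C ((u + k + l) * (s + k - u - l)) * (latProd s s k * latProd s u l) := by
  rw [latProd_succ, latProd_succ]
  have : (C ((s + k) * (s + k - s)) : ℂ[X]) = C ((u + l) * (u + l - s))
      + C ((u + k + l) * (s + k - u - l)) := by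
    rw [← C_add]; congr 1; ring
  rw [this]; ring

theorem latProd_degree_leadingCoeff (s u : ℂ) (l : ℕ) :
    (latProd s u l).degree = l ∧ (latProd s u l).leadingCoeff = (-1) ^ l := by
  have h1 : ∀ c : ℂ, (C c - X : ℂ[X]).degree = 1 := fun c => by
    rw [← neg_sub, degree_neg, degree_X_sub_C]
  have h2 : ∀ c : ℂ, (C c - X : ℂ[X]).leadingCoeff = -1 := fun c => by
    rw [← neg_sub, leadingCoeff_neg, leadingCoeff_X_sub_C]
  constructor
  · simp only [latProd, degree_prod, h1]; simp
  · simp only [latProd, leadingCoeff_prod, h2]; simp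

/-- The products `latProd s u l`, as a sequence of polynomials of degrees `0, 1, 2, …`. -/
def latSeq (s u : ℂ) : Polynomial.Sequence ℂ where
  elems' := latProd s u
  degree_eq' l := (latProd_degree_leadingCoeff s u l).1

theorem span_latProd (s u : ℂ) : Submodule.span ℂ (Set.range (latProd s u)) = ⊤ :=
  (latSeq s u).span fun i =>
    (latProd_degree_leadingCoeff s u i).2 ▸ (isUnit_one.neg.pow i)

theorem span_latProd_lt (s u : ℂ) (m : ℕ) :
    Submodule.span ℂ (latProd s u '' Set.Iio m) = degreeLT ℂ m :=
  (latSeq s u).span_degreeLT fun i _ =>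
    (latProd_degree_leadingCoeff s u i).2 ▸ (isUnit_one.neg.pow i)

/-- The common form of the dual Hahn and continuous dual Hahn polynomials. -/
def hahnFamily (s u v : ℂ) (n : ℕ) : ℂ[X] :=
  ∑ k ∈ Finset.range (n + 1),
    C (poch (-(n : ℂ)) k / (k.factorial : ℂ) * poch (v + k) (n - k) * poch (u + k) (n - k))
      * latProd s s k

theorem dualHahn_eq_hahnFamily (γ δ : ℂ) (N n : ℕ) :
    dualHahn γ δ N n = hahnFamily (γ + δ + 1) (-(N : ℂ)) (γ + 1) n := by
  refine Finset.sum_congr rfl fun k _ => ?_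
  congr 1
  refine Finset.prod_congr rfl fun j _ => ?_
  congr 2; ring

/-- Both terms are monic of degree n. In computing the norm, this replaces one copy of the
orthogonal polynomial by a single element of the testing basis. -/
theorem hahnFamily_sub_natDegree_lt (s u v : ℂ) (n : ℕ) :
    hahnFamily s u v n - C ((-1) ^ n) * latProd s u n ∈ degreeLT ℂ n := by
  have key : ∀ a : ℂ, C ((-1) ^ n) * latProd s a n - X ^ n ∈ degreeLT ℂ n := fun a => by
    rw [mem_degreeLT]
    obtain ⟨hd, hl⟩ := latProd_degree_leadingCoeff s a n
    have h1 : (C ((-1 : ℂ) ^ n)).degree = 0 := degree_C (by simp)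
    have h2 : (C ((-1) ^ n) * latProd s a n).degree = (n : WithBot ℕ) := by rw [degree_mul, h1, hd, zero_add]
    rw [← h2]
    refine degree_sub_lt_left ?_ ?_ ?_
    · rw [h2, degree_X_pow]
    · rw [← degree_ne_bot, h2]; simp
    · rw [leadingCoeff_mul, leadingCoeff_C, hl, leadingCoeff_X_pow, ← mul_pow]; simp
  have h3 : hahnFamily s u v n - C ((-1) ^ n) * latProd s s n ∈ degreeLT ℂ n := by
    rw [hahnFamily, Finset.sum_range_succ, poch_neg_natCast_div_factorial]
    simp only [Nat.choose_self, Nat.cast_one, mul_one, Nat.sub_self, poch_zero, add_sub_cancel_right]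
    refine Submodule.sum_mem _ fun k hk => ?_
    rw [mem_degreeLT, ← smul_eq_C_mul]
    refine (degree_smul_le _ _).trans_lt ?_
    rw [(latProd_degree_leadingCoeff s s k).1]
    exact_mod_cast Finset.mem_range.mp hk
  have := Submodule.add_mem _ h3 (Submodule.sub_mem _ (key s) (key u))
  convert this using 1; ring

/-- Up to the sign (-1)^n this is the n-th forward difference, at u, of a monic polynomial of degree
l. -/
theorem sum_neg_one_pow_choose_mul_poch (u : ℂ) (n l : ℕ) (h : l ≤ n) :
    ∑ k ∈ Finset.range (n + 1), (-1) ^ k * (n.choose k : ℂ) * poch (u + k) l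
      = if l = n then (-1) ^ n * (n.factorial : ℂ) else 0 := by
  have hdeg : (ascPochhammer ℂ l).natDegree = l := ascPochhammer_natDegree ℂ l
  have h1 := fwdDiff_iter_eq_sum_shift (1 : ℂ) (ascPochhammer ℂ l).eval n u
  have h2 : ∑ k ∈ Finset.range (n + 1), (-1) ^ k * (n.choose k : ℂ) * poch (u + k) l
      = (-1) ^ n * (fwdDiff (1 : ℂ))^[n] (ascPochhammer ℂ l).eval u := by
    rw [h1, Finset.mul_sum]
    refine Finset.sum_congr rfl fun k hk => ?_
    have hk : k ≤ n := Nat.lt_succ_iff.mp (Finset.mem_range.mp hk)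
    have : ((-1 : ℂ)) ^ n * (-1) ^ (n - k) = (-1) ^ k := by
      obtain ⟨m, rfl⟩ := Nat.exists_eq_add_of_le hk
      rw [Nat.add_sub_cancel_left, pow_add, mul_assoc, ← mul_pow]; simp
    rw [← this, poch]
    simp only [zsmul_eq_mul, nsmul_eq_mul, mul_one]
    push_cast; ring
  rw [h2]
  split_ifs with hl
  · subst hl
    have := Polynomial.fwdDiff_iter_degree_eq_factorial (ascPochhammer ℂ l)
    rw [hdeg] at this
    rw [this, (monic_ascPochhammer ℂ l).leadingCoeff]
    simp
  · rw [Polynomial.fwdDiff_iter_eq_zero_of_degree_lt (by rw [hdeg]; omega)]; simp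

/-! ### Orthogonality and norms from mixed moments -/

section Functional
variable {s u v w K : ℂ} {L : ℂ[X] →ₗ[ℂ] ℂ}

/-- The coefficients complete (u)_k and (v)_k to (u)_n and (v)_n, which leave the sum. Only (u+k)_l
still depends on k, and a finite difference remains. -/
theorem functional_hahnFamily_mul_latProd
    (hL : ∀ k l, L (latProd s s k * latProd s u l) = K * poch u (k + l) * poch v k * poch w l)
    {n l : ℕ} (h : l ≤ n) : L (hahnFamily s u v n * latProd s u l) =
      if l = n then K * poch u n * poch v n * poch w n * ((-1) ^ n * n.factorial) else 0 := by
  have h1 : L (hahnFamily s u v n * latProd s u l) = K * poch u n * poch v n * poch w l *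
      ∑ k ∈ Finset.range (n + 1), (-1) ^ k * (n.choose k : ℂ) * poch (u + k) l := by
    rw [hahnFamily, Finset.sum_mul, map_sum, Finset.mul_sum]
    refine Finset.sum_congr rfl fun k hk => ?_
    have hk : k ≤ n := Nat.lt_succ_iff.mp (Finset.mem_range.mp hk)
    rw [mul_assoc, ← smul_eq_C_mul, map_smul, hL, poch_neg_natCast_div_factorial, poch_add,
      ← poch_split u hk, ← poch_split v hk, smul_eq_mul]
    ring
  rw [h1, sum_neg_one_pow_choose_mul_poch u n l h]
  split_ifs with hl
  · rw [hl]
  · simp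

theorem functional_hahnFamily_mul_of_degree_lt
    (hL : ∀ k l, L (latProd s s k * latProd s u l) = K * poch u (k + l) * poch v k * poch w l)
    {n : ℕ} {p : ℂ[X]} (hp : p ∈ degreeLT ℂ n) : L (hahnFamily s u v n * p) = 0 := by
  rw [← span_latProd_lt s u] at hp
  induction hp using Submodule.span_induction with
  | mem x hx =>
    obtain ⟨l, hl, rfl⟩ := hx
    have hl : l < n := hl
    rw [functional_hahnFamily_mul_latProd hL hl.le, if_neg hl.ne]
  | zero => simp
  | add x y _ _ hx hy => rw [mul_add, map_add, hx, hy, add_zero]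
  | smul a x _ hx => rw [mul_smul_comm, map_smul, hx, smul_zero]

theorem hahnFamily_mem_degreeLT (s u v : ℂ) {m n : ℕ} (h : m < n) :
    hahnFamily s u v m ∈ degreeLT ℂ n := by
  refine Submodule.sum_mem _ fun k hk => ?_
  rw [mem_degreeLT, ← smul_eq_C_mul]
  refine (degree_smul_le _ _).trans_lt ?_
  rw [(latProd_degree_leadingCoeff s s k).1]
  have := Finset.mem_range.mp hk
  exact_mod_cast (by omega : k < n)

theorem functional_hahnFamily_orthogonal
    (hL : ∀ k l, L (latProd s s k * latProd s u l) = K * poch u (k + l) * poch v k * poch w l)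
    {m n : ℕ} (h : m ≠ n) : L (hahnFamily s u v m * hahnFamily s u v n) = 0 := by
  rcases h.lt_or_gt with h | h
  · rw [mul_comm]
    exact functional_hahnFamily_mul_of_degree_lt hL (hahnFamily_mem_degreeLT s u v h)
  · exact functional_hahnFamily_mul_of_degree_lt hL (hahnFamily_mem_degreeLT s u v h)

theorem functional_hahnFamily_sq
    (hL : ∀ k l, L (latProd s s k * latProd s u l) = K * poch u (k + l) * poch v k * poch w l)
    (n : ℕ) : L (hahnFamily s u v n * hahnFamily s u v n) =
      K * poch u n * poch v n * poch w n * n.factorial := by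
  have h1 := functional_hahnFamily_mul_of_degree_lt hL (hahnFamily_sub_natDegree_lt s u v n)
  rw [mul_sub, map_sub, sub_eq_zero] at h1
  rw [h1, mul_left_comm, ← smul_eq_C_mul, map_smul, functional_hahnFamily_mul_latProd hL le_rfl,
    if_pos rfl, smul_eq_mul]
  have : ((-1 : ℂ)) ^ n * (-1) ^ n = 1 := by rw [← mul_pow]; simp
  linear_combination (K * poch u n * poch v n * poch w n * n.factorial) * this

/-- In the recursion raising k, the two terms combine through (w+l) + (s+k-u-l) = v+k, which forces
w = v-s+u. -/
theorem functional_moments_of_latProd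
    (hL : ∀ l, L (latProd s u l) = K * poch u l * poch (v - s + u) l) (k l : ℕ) :
    L (latProd s s k * latProd s u l) =
      K * poch u (k + l) * poch v k * poch (v - s + u) l := by
  induction k generalizing l with
  | zero => simp [latProd, poch_zero, ← hL]
  | succ k ih =>
    rw [latProd_succ_mul, map_add, ← smul_eq_C_mul, map_smul, ih, ih, smul_eq_mul,
      show k + 1 + l = k + l + 1 by ring, show k + (l + 1) = k + l + 1 by ring, poch_succ,
      poch_succ, poch_succ]
    push_cast; ring

/-- For u = -N the pure moments are not directly available, so the recursion is run downwards from
the diagonal k+l = N. It requires division by (-N+k+l)(s+k+N-l); the second factor equals s+i with i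
= 2k+d+1, where d+1 = N-k-l. -/
theorem functional_moments_of_diagonal {N : ℕ}
    (hs : ∀ i : ℕ, 1 ≤ i → i < 2 * N → s + i ≠ 0)
    (h0 : ∀ k l, N < k + l → L (latProd s s k * latProd s (-(N : ℂ)) l) = 0)
    (hd : ∀ k l, k + l = N → L (latProd s s k * latProd s (-(N : ℂ)) l) =
      K * poch (-(N : ℂ)) (k + l) * poch v k * poch (v - s - N) l) (k l : ℕ) :
    L (latProd s s k * latProd s (-(N : ℂ)) l) =
      K * poch (-(N : ℂ)) (k + l) * poch v k * poch (v - s - N) l := by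
  rcases lt_or_ge N (k + l) with h | h
  · rw [h0 k l h, poch_neg_natCast, Nat.descFactorial_of_lt h]; simp
  obtain ⟨d, hd'⟩ := Nat.exists_eq_add_of_le h
  induction d generalizing k l with
  | zero => exact hd k l (by omega)
  | succ d ih =>
    have e1 := ih (k + 1) l (by omega) (by omega)
    have e2 := ih k (l + 1) (by omega) (by omega)
    rw [latProd_succ_mul, map_add, ← smul_eq_C_mul, map_smul, e2, smul_eq_mul,
      show k + 1 + l = k + l + 1 by ring, show k + (l + 1) = k + l + 1 by ring, poch_succ,
      poch_succ, poch_succ] at e1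
    have hn1 : (-(N : ℂ) + k + l) ≠ 0 := by
      have : (N : ℂ) = k + l + (d + 1) := by rw [hd']; push_cast; ring
      rw [this]
      have : ((d + 1 : ℕ) : ℂ) ≠ 0 := by exact_mod_cast d.succ_ne_zero
      intro h; apply this; push_cast; linear_combination -h
    have hn2 : s + k - -(N : ℂ) - l ≠ 0 := by
      have := hs (2 * k + d + 1) (by omega) (by omega)
      intro h; apply this
      have hN : (N : ℂ) = k + l + (d + 1) := by rw [hd']; push_cast; ring
      rw [hN] at h; push_cast; linear_combination h
    have hm := mul_ne_zero hn1 hn2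
    apply mul_left_cancel₀ hm
    push_cast at e1
    linear_combination e1

end Functional

/-! ### Factorization beyond degree N -/

theorem poch_neg_add_eq_zero {N n k : ℕ} (hk : k ≤ N) (hn : N < n) :
    poch (-(N : ℂ) + k) (n - k) = 0 := by
  by_contra h
  refine poch_ne_zero.mp h (N - k) (by omega) ?_
  rw [Nat.cast_sub hk]; ring

theorem poch_natCast_add_one_mul_factorial (a b : ℕ) :
    poch ((a : ℂ) + 1) b * a.factorial = (a + b).factorial := by
  rw [← poch_one, ← poch_one, poch_add, add_comm (1 : ℂ), mul_comm]

theorem dualHahn_succ_eval_lat (γ δ x : ℂ) (N : ℕ) :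
    (dualHahn γ δ N (N + 1)).eval (lat γ δ x) =
      (-1) ^ (N + 1) * (poch (-x) (N + 1) * poch (x + γ + δ + 1) (N + 1)) := by
  rw [dualHahn_eval_lat, Finset.sum_range_succ, Finset.sum_eq_zero, zero_add,
    poch_neg_natCast_div_factorial]
  · simp [poch_zero]
  · intro k hk
    rw [poch_neg_add_eq_zero (Nat.lt_succ_iff.mp (Finset.mem_range.mp hk)) (Nat.lt_succ_self N)]
    ring

/-- The terms with k ≤ N vanish. Putting k = N+1+j, the products (-x)_k (x+γ+δ+1)_k split off their
first N+1 factors, which form R_{N+1} up to sign, and the remaining coefficients match by factorial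
identities. -/
theorem dualHahn_factorization (γ δ : ℂ) (N n : ℕ) (hn : N < n) (x : ℂ) :
    (dualHahn γ δ N n).eval (lat γ δ x) =
      (dualHahn γ δ N (N + 1)).eval (lat γ δ x) * (-1) ^ (n - N - 1) *
        (contDualHahn (N + (γ + δ + 3) / 2) ((-γ - δ + 1) / 2) ((γ - δ + 1) / 2)
          (n - N - 1)).eval ((Complex.I * x + Complex.I * ((γ + δ + 1) / 2)) ^ 2) := by
  obtain ⟨m, rfl⟩ : ∃ m, n = N + 1 + m := ⟨n - N - 1, by omega⟩
  rw [show N + 1 + m - N - 1 = m by omega, contDualHahn_eval_sq, dualHahn_succ_eval_lat,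
    dualHahn_eval_lat, show N + 1 + m + 1 = N + 1 + (m + 1) by ring, Finset.sum_range_add,
    Finset.sum_eq_zero, zero_add, mul_assoc, ← mul_assoc ((-1 : ℂ) ^ m), ← mul_pow, Finset.mul_sum,
    Finset.mul_sum]
  · refine Finset.sum_congr rfl fun j hj => ?_
    have hj : j ≤ m := Nat.lt_succ_iff.mp (Finset.mem_range.mp hj)
    obtain ⟨i, rfl⟩ := Nat.exists_eq_add_of_le hj
    have hI := Complex.I_mul_I
    rw [show N + 1 + (j + i) - (N + 1 + j) = i by omega, show j + i - j = i by omega,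
      poch_neg_natCast_div_factorial, poch_neg_natCast_div_factorial,
      poch_add (-x), poch_add (x + γ + δ + 1)]
    have e1 : (N : ℂ) + (γ + δ + 3) / 2 + Complex.I * (Complex.I * x + Complex.I *
        ((γ + δ + 1) / 2)) = -x + (N + 1 : ℕ) := by
      push_cast; linear_combination (x + (γ + δ + 1) / 2) * hI
    have e2 : (N : ℂ) + (γ + δ + 3) / 2 - Complex.I * (Complex.I * x + Complex.I *
        ((γ + δ + 1) / 2)) = x + γ + δ + 1 + (N + 1 : ℕ) := by
      push_cast; linear_combination -(x + (γ + δ + 1) / 2) * hI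
    have e3 : (N : ℂ) + (γ + δ + 3) / 2 + (-γ - δ + 1) / 2 + j = ((N + 1 + j : ℕ) : ℂ) + 1 := by
      push_cast; ring
    have e4 : (N : ℂ) + (γ + δ + 3) / 2 + (γ - δ + 1) / 2 + j = γ + 1 + (N + 1 + j : ℕ) := by
      push_cast; ring
    have e5 : -(N : ℂ) + (N + 1 + j : ℕ) = j + 1 := by push_cast; ring
    rw [e1, e2, e3, e4, e5]
    have c1 := Nat.choose_mul_factorial_mul_factorial (show N + 1 + j ≤ N + 1 + (j + i) by omega)
    have c2 := Nat.choose_mul_factorial_mul_factorial (show j ≤ j + i by omega)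
    rw [show N + 1 + (j + i) - (N + 1 + j) = i by omega] at c1
    rw [show j + i - j = i by omega] at c2
    have p1 := poch_natCast_add_one_mul_factorial (N + 1 + j) i
    have p2 := poch_natCast_add_one_mul_factorial j i
    rw [add_assoc (N + 1) j i, ← c1] at p1
    rw [← c2] at p2
    have f1 : ((N + 1 + j).factorial : ℂ) ≠ 0 := by exact_mod_cast Nat.factorial_ne_zero _
    have f2 : (j.factorial : ℂ) ≠ 0 := by exact_mod_cast Nat.factorial_ne_zero _
    push_cast at p1 p2 f1
    have q1 : poch ((N : ℂ) + 1 + j + 1) i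
        = ((N + 1 + (j + i)).choose (N + 1 + j) : ℂ) * i.factorial := by
      apply mul_right_cancel₀ f1; linear_combination p1
    have q2 : poch ((j : ℂ) + 1) i = ((j + i).choose j : ℂ) * i.factorial := by
      apply mul_right_cancel₀ f2; linear_combination p2
    push_cast
    rw [q1, q2]
    simp only [neg_mul_neg, one_mul, one_pow, mul_one]
    ring
  · intro k hk
    rw [poch_neg_add_eq_zero (Nat.lt_succ_iff.mp (Finset.mem_range.mp hk)) (by omega)]
    ring

theorem dualHahn_eval_lat_natCast_eq_zero (γ δ : ℂ) {N n x : ℕ} (hn : N < n) (hx : x ≤ N) :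
    (dualHahn γ δ N n).eval (lat γ δ x) = 0 := by
  rw [dualHahn_factorization γ δ N n hn, dualHahn_succ_eval_lat, poch_neg_natCast,
    Nat.descFactorial_of_lt (by omega)]
  simp

/-! ### Moments of the discrete part -/

/-- The discrete part of the bilinear form, as a functional. -/
def discreteFunctional (γ δ : ℂ) (N : ℕ) : ℂ[X] →ₗ[ℂ] ℂ :=
  ∑ x ∈ Finset.range (N + 1), discreteWeight γ δ N x • leval (lat γ δ x)

theorem discreteFunctional_apply (γ δ : ℂ) (N : ℕ) (p : ℂ[X]) :
    discreteFunctional γ δ N p =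
      ∑ x ∈ Finset.range (N + 1), p.eval (lat γ δ x) * discreteWeight γ δ N x := by
  simp [discreteFunctional, leval_apply, mul_comm]

theorem latProd_eval_lat (γ δ u x : ℂ) (l : ℕ) :
    (latProd (γ + δ + 1) u l).eval (lat γ δ x) =
      poch (x + u) l * poch (u - (γ + δ + 1) - x) l := by
  rw [← latProd_eval, lat]; congr 1; ring

theorem discreteFunctional_moments (γ δ : ℂ) (N : ℕ)
    (h : ∀ x : ℕ, x ≤ N → poch (x + γ + δ + 1) (N + 1) ≠ 0 ∧ poch (δ + 1) x ≠ 0) (k l : ℕ) :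
    discreteFunctional γ δ N (latProd (γ + δ + 1) (γ + δ + 1) k
        * latProd (γ + δ + 1) (-(N : ℂ)) l) =
      (poch (δ + 1) N)⁻¹ * poch (-(N : ℂ)) (k + l) * poch (γ + 1) k
        * poch (γ + 1 - (γ + δ + 1) - N) l := by
  have hzero : ∀ k l x : ℕ, x ≤ N → (x < k ∨ N < x + l) →
      (latProd (γ + δ + 1) (γ + δ + 1) k
        * latProd (γ + δ + 1) (-(N : ℂ)) l).eval (lat γ δ x) = 0 := by
    intro k l x hx hkl
    rw [eval_mul, latProd_eval_lat, latProd_eval_lat, sub_self, zero_sub]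
    rcases hkl with hkl | hkl
    · rw [poch_neg_natCast, Nat.descFactorial_of_lt hkl]; simp
    · rw [show (x : ℂ) + -N = -((N - x : ℕ) : ℂ) by rw [Nat.cast_sub hx]; ring,
        poch_neg_natCast (N - x), Nat.descFactorial_of_lt (show N - x < l by omega)]
      simp
  refine functional_moments_of_diagonal ?_ ?_ ?_ k l
  · intro i _ hi
    have key : ∀ x j : ℕ, x ≤ N → j ≤ N → γ + δ + 1 + (x + j : ℕ) ≠ 0 := fun x j hx hj h0 =>
      poch_ne_zero.mp (h x hx).1 j (by omega) (by push_cast at h0; linear_combination h0)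
    -- The nonvanishing hypotheses cover s+x+j for 0 ≤ x, j ≤ N, and every i < 2N is such a sum x+j.
    have := key (min i N) (i - min i N) (by omega) (by omega)
    rwa [show min i N + (i - min i N) = i by omega] at this
  · intro k l hkl
    rw [discreteFunctional_apply]
    refine Finset.sum_eq_zero fun x hx => ?_
    have hx := Finset.mem_range.mp hx
    rw [hzero k l x (by omega) (by omega), zero_mul]
  · intro k l hkl
    subst hkl
    -- The first product vanishes at nodes x < k and the second at x > N-l = k.
    rw [discreteFunctional_apply, Finset.sum_eq_single k]
    · rw [eval_mul, latProd_eval_lat, latProd_eval_lat, sub_self, zero_sub, discreteWeight]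
      obtain ⟨h1, h2⟩ := h k (by omega)
      obtain ⟨-, h3⟩ := h (k + l) le_rfl
      rw [poch_add] at h3
      -- This isolates the factor 2k+γ+δ+1 of the denominator, which cancels the numerator of the
      -- mass.
      have h4 := poch_split ((k : ℂ) + γ + δ + 1) (show k ≤ k + l + 1 by omega)
      rw [show k + l + 1 - k = l + 1 by omega, poch_succ_left] at h4
      rw [← h4] at h1 ⊢
      have h5 := left_ne_zero_of_mul h1
      have h6 := left_ne_zero_of_mul (right_ne_zero_of_mul h1)
      have h7 := right_ne_zero_of_mul (right_ne_zero_of_mul h1)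
      have h8 := right_ne_zero_of_mul h3
      have h9 : (k.factorial : ℂ) ≠ 0 := by exact_mod_cast k.factorial_ne_zero
      have e1 : poch ((k : ℂ) + -((k + l : ℕ) : ℂ)) l = (-1) ^ l * l.factorial := by
        rw [show (k : ℂ) + -((k + l : ℕ) : ℂ) = -(l : ℂ) by push_cast; ring, poch_neg_natCast,
          Nat.descFactorial_self]
      have e2 : poch (-((k + l : ℕ) : ℂ) - (γ + δ + 1) - k) l
          = (-1) ^ l * poch ((k : ℂ) + γ + δ + 1 + k + 1) l := by
        rw [show -((k + l : ℕ) : ℂ) - (γ + δ + 1) - k = -(k + γ + δ + 1 + k + l) by push_cast; ring,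
          poch_neg]
        congr 2; ring
      have e3 : poch (γ + 1 - (γ + δ + 1) - ((k + l : ℕ) : ℂ)) l
          = (-1) ^ l * poch (δ + 1 + k) l := by
        rw [show γ + 1 - (γ + δ + 1) - ((k + l : ℕ) : ℂ) = -(δ + k + l) by push_cast; ring, poch_neg]
        congr 2; ring
      have e4 : poch (-((k + l : ℕ) : ℂ)) (k + l)
          = poch (-((k + l : ℕ) : ℂ)) k * ((-1) ^ l * l.factorial) := by
        rw [poch_add, ← e1]; congr 2; ring
      rw [e1, e2, e3, e4, poch_neg_natCast k, Nat.descFactorial_self, poch_one, poch_add (δ + 1),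
        show (k : ℂ) + (γ + δ + 1) = k + γ + δ + 1 by ring,
        show 2 * (k : ℂ) + γ + δ + 1 = k + γ + δ + 1 + k by ring]
      have s1 : ((-1 : ℂ)) ^ k ≠ 0 := by simp
      field_simp
    · intro x hx hxk
      have hx := Finset.mem_range.mp hx
      rw [hzero k l x (by omega) (by omega), zero_mul]
    · intro hk; exact absurd (Finset.mem_range.mpr (by omega)) hk

/-! ### Divided differences in the basis of lattice products -/

/-- `(Δ/Δλ)^j` sends the polynomial `p` on the lattice to `r` on the shifted lattice, off a finite
set. -/
def HasLatDiff (γ δ : ℂ) (j : ℕ) (p r : ℂ[X]) : Prop :=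
  ∃ E : Finset ℂ, ∀ x ∉ E,
    latDiff γ δ j (fun y => p.eval (lat γ δ y)) x = r.eval (x * (x + (γ + δ + 1 + j)))

theorem latDiff_add (γ δ : ℂ) (j : ℕ) (f g : ℂ → ℂ) :
    latDiff γ δ j (f + g) = latDiff γ δ j f + latDiff γ δ j g := by
  induction j with
  | zero => rfl
  | succ j ih => funext x; simp only [latDiff, ih, Pi.add_apply]; ring

theorem latDiff_smul (γ δ : ℂ) (j : ℕ) (a : ℂ) (f : ℂ → ℂ) :
    latDiff γ δ j (a • f) = a • latDiff γ δ j f := by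
  induction j with
  | zero => rfl
  | succ j ih => funext x; simp only [latDiff, ih, Pi.smul_apply, smul_eq_mul]; ring

theorem HasLatDiff.add {γ δ : ℂ} {j : ℕ} {p r p' r' : ℂ[X]} (h : HasLatDiff γ δ j p r)
    (h' : HasLatDiff γ δ j p' r') : HasLatDiff γ δ j (p + p') (r + r') := by
  classical
  obtain ⟨E, hE⟩ := h
  obtain ⟨E', hE'⟩ := h'
  refine ⟨E ∪ E', fun x hx => ?_⟩
  rw [Finset.mem_union, not_or] at hx
  rw [eval_add, ← hE x hx.1, ← hE' x hx.2, ← Pi.add_apply (latDiff _ _ _ _), ← latDiff_add]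
  congr 1; funext y; simp

theorem HasLatDiff.smul {γ δ : ℂ} {j : ℕ} {p r : ℂ[X]} (a : ℂ) (h : HasLatDiff γ δ j p r) :
    HasLatDiff γ δ j (a • p) (a • r) := by
  obtain ⟨E, hE⟩ := h
  refine ⟨E, fun x hx => ?_⟩
  rw [eval_smul, ← hE x hx, ← Pi.smul_apply, ← latDiff_smul]
  congr 1; funext y; simp

theorem HasLatDiff.zero (γ δ : ℂ) (j : ℕ) : HasLatDiff γ δ j 0 0 := by
  refine ⟨∅, fun x _ => ?_⟩
  have := latDiff_smul γ δ j 0 0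
  rw [zero_smul, zero_smul] at this
  simp only [eval_zero]
  exact congrFun this x

theorem HasLatDiff.sum {γ δ : ℂ} {j : ℕ} {ι : Type*} (S : Finset ι) {p r : ι → ℂ[X]}
    (h : ∀ i ∈ S, HasLatDiff γ δ j (p i) (r i)) :
    HasLatDiff γ δ j (∑ i ∈ S, p i) (∑ i ∈ S, r i) := by
  classical
  induction S using Finset.induction_on with
  | empty => simpa using HasLatDiff.zero γ δ j
  | insert i S hi ih =>
    rw [Finset.sum_insert hi, Finset.sum_insert hi]
    exact (h i (Finset.mem_insert_self i S)).add
      (ih fun i' hi' => h i' (Finset.mem_insert_of_mem hi'))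

/-- The products at x and x+1 share all but their end factors. The quotient by the step 2x+1+s of
the lattice is again a product of this type, with s raised by one. -/
theorem latProd_self_eval_diff (s x : ℂ) (k : ℕ) :
    (latProd s s k).eval ((x + 1) * (x + 1 + s)) - (latProd s s k).eval (x * (x + s)) =
      -k * (2 * x + 1 + s) * (latProd (s + 1) (s + 1) (k - 1)).eval (x * (x + (s + 1))) := by
  simp only [latProd_eval, sub_self, zero_sub]
  cases k with
  | zero => simp [poch_zero]
  | succ k =>
    rw [Nat.add_sub_cancel, poch_succ (x + 1 + s), poch_succ_left (x + s), poch_succ (-x),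
      poch_succ_left (-(x + 1)), show -(x + 1) + 1 = -x by ring,
      show x + 1 + s = x + s + 1 by ring, show x + (s + 1) = x + s + 1 by ring]
    push_cast; ring

theorem hasLatDiff_latProd (γ δ : ℂ) (j k : ℕ) :
    HasLatDiff γ δ j (latProd (γ + δ + 1) (γ + δ + 1) k)
      (((-1) ^ j * (k.descFactorial j : ℂ)) •
        latProd (γ + δ + 1 + j) (γ + δ + 1 + j) (k - j)) := by
  classical
  induction j with
  | zero =>
    refine ⟨∅, fun x _ => ?_⟩
    simp only [latDiff, lat]
    simp only [pow_zero, Nat.descFactorial_zero, Nat.cast_one, mul_one, one_smul, Nat.cast_zero,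
      add_zero, Nat.sub_zero]
    congr 1; ring
  | succ j ih =>
    obtain ⟨E, hE⟩ := ih
    -- The formula is needed at x and at x+1; the last point is the zero of the lattice step, where
    -- the quotient is 0 by convention.
    refine ⟨E ∪ E.image (fun z => z - 1) ∪ {-(γ + δ + 1 + j + 1) / 2}, fun x hx => ?_⟩
    simp only [Finset.mem_union, Finset.mem_image, Finset.mem_singleton, not_or] at hx
    obtain ⟨⟨h1, h2⟩, h3⟩ := hx
    have h2 : x + 1 ∉ E := fun h => h2 ⟨x + 1, h, by ring⟩
    have h4 : 2 * x + 1 + (γ + δ + 1 + j) ≠ 0 := fun h => h3 (by linear_combination h / 2)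
    simp only [latDiff]
    rw [hE x h1, hE (x + 1) h2, eval_smul, eval_smul, ← smul_sub, latProd_self_eval_diff,
      eval_smul, Nat.descFactorial_succ, Nat.sub_sub,
      show lat (γ + j) δ (x + 1) - lat (γ + j) δ x = 2 * x + 1 + (γ + δ + 1 + j) by
        simp only [lat]; ring]
    rw [div_eq_iff h4, show γ + δ + 1 + j + 1 = γ + δ + 1 + (j + 1 : ℕ) by push_cast; ring]
    simp only [smul_eq_mul]
    push_cast; ring

theorem exists_hasLatDiff (γ δ : ℂ) (j : ℕ) (p : ℂ[X]) : ∃ r, HasLatDiff γ δ j p r := by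
  have hp : p ∈ Submodule.span ℂ (Set.range (latProd (γ + δ + 1) (γ + δ + 1))) := by
    rw [span_latProd]; trivial
  induction hp using Submodule.span_induction with
  | mem x hx => obtain ⟨k, rfl⟩ := hx; exact ⟨_, hasLatDiff_latProd γ δ j k⟩
  | zero => exact ⟨_, HasLatDiff.zero γ δ j⟩
  | add x y _ _ hx hy => exact ⟨_, hx.choose_spec.add hy.choose_spec⟩
  | smul a x _ hx => exact ⟨_, hx.choose_spec.smul a⟩

theorem hasLatDiff_dualHahn_of_le (γ δ : ℂ) {N n : ℕ} (hn : n ≤ N) :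
    HasLatDiff γ δ (N + 1) (dualHahn γ δ N n) 0 := by
  rw [dualHahn_eq_hahnFamily, hahnFamily, ← Finset.sum_const_zero (ι := ℕ)]
  refine HasLatDiff.sum _ fun k hk => ?_
  have hk := Finset.mem_range.mp hk
  have := (hasLatDiff_latProd γ δ (N + 1) k).smul
    (poch (-(n : ℂ)) k / (k.factorial : ℂ) * poch (γ + 1 + k) (n - k) * poch (-(N : ℂ) + k) (n - k))
  rw [Nat.descFactorial_of_lt (by omega)] at this
  simpa [smul_eq_C_mul] using this

/-- Only indices k = N+1+j survive, and differencing lowers them to j. The parameters -N and γ+1 are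
raised by N+1 to 1 and γ+N+2. The coefficients are symmetric in these two, and γ+N+2 is put in the
role of u to fit the Gamma factors of the weight. -/
theorem hasLatDiff_dualHahn_of_lt (γ δ : ℂ) (N m : ℕ) :
    HasLatDiff γ δ (N + 1) (dualHahn γ δ N (N + 1 + m))
      (((N + 1 + m).descFactorial (N + 1) : ℂ) • hahnFamily (γ + δ + N + 2) (γ + N + 2) 1 m) := by
  have h := HasLatDiff.sum (Finset.range (N + 1 + m + 1)) fun k _ =>
    (hasLatDiff_latProd γ δ (N + 1) k).smul
    (poch (-((N + 1 + m : ℕ) : ℂ)) k / (k.factorial : ℂ) * poch (γ + 1 + k) (N + 1 + m - k)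
      * poch (-(N : ℂ) + k) (N + 1 + m - k))
  rw [dualHahn_eq_hahnFamily, hahnFamily]
  simp only [← smul_eq_C_mul]
  convert h using 1
  rw [show N + 1 + m + 1 = N + 1 + (m + 1) by ring, Finset.sum_range_add, Finset.sum_eq_zero,
    zero_add, hahnFamily, Finset.smul_sum]
  · refine Finset.sum_congr rfl fun j hj => ?_
    have hj : j ≤ m := Nat.lt_succ_iff.mp (Finset.mem_range.mp hj)
    obtain ⟨i, rfl⟩ := Nat.exists_eq_add_of_le hj
    rw [← smul_eq_C_mul, smul_smul, smul_smul, show N + 1 + (j + i) - (N + 1 + j) = i by omega,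
      show j + i - j = i by omega, show N + 1 + j - (N + 1) = j by omega,
      show γ + δ + 1 + ((N + 1 : ℕ) : ℂ) = γ + δ + N + 2 by push_cast; ring,
      show γ + 1 + ((N + 1 + j : ℕ) : ℂ) = γ + N + 2 + j by push_cast; ring,
      show -(N : ℂ) + ((N + 1 + j : ℕ) : ℂ) = 1 + j by push_cast; ring]
    congr 1
    rw [poch_neg_natCast_div_factorial, poch_neg_natCast, pow_add]
    have d1 := Nat.descFactorial_eq_factorial_mul_choose (N + 1 + j) (N + 1)
    have hf : ((N + 1 + j).factorial : ℂ) ≠ 0 := by exact_mod_cast Nat.factorial_ne_zero _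
    have hf2 : (j.factorial : ℂ) ≠ 0 := by exact_mod_cast Nat.factorial_ne_zero _
    have c1 : (N + 1 + j).descFactorial (N + 1) * j.factorial = (N + 1 + j).factorial := by
      have := Nat.factorial_mul_descFactorial (show N + 1 ≤ N + 1 + j by omega)
      rwa [show N + 1 + j - (N + 1) = j by omega, mul_comm] at this
    have c2 : (N + 1 + (j + i)).descFactorial (N + 1 + j)
        = (N + 1 + (j + i)).descFactorial (N + 1) * (j.factorial * (j + i).choose j) := by
      have := Nat.descFactorial_mul_descFactorial (n := N + 1 + (j + i))
        (show N + 1 ≤ N + 1 + j by omega)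
      rw [← this, show N + 1 + (j + i) - (N + 1) = j + i by omega,
        show N + 1 + j - (N + 1) = j by omega, Nat.descFactorial_eq_factorial_mul_choose (j + i) j]
      ring
    rw [← c1, c2]
    have hd : ((N + 1 + j).descFactorial (N + 1) : ℂ) ≠ 0 := by
      rw [← c1] at hf; push_cast at hf; exact left_ne_zero_of_mul hf
    have hs : ((-1 : ℂ)) ^ (N + 1) * (-1) ^ (N + 1) = 1 := by rw [← mul_pow]; simp
    push_cast
    field_simp
    linear_combination -(((N + 1 + (j + i)).descFactorial (N + 1) : ℂ) * (j + i).choose j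
      * poch (1 + j) i * poch (γ + N + 2 + j) i) * hs
  · intro k hk
    rw [poch_neg_add_eq_zero (Nat.lt_succ_iff.mp (Finset.mem_range.mp hk)) (by omega)]
    simp

end Algebraic

/-! ### Sides of a contour, measured by integrals of 1/(z-p) -/

section Analytic

open Filter Topology Set

/-- The two points are conjugate, so the difference is 2i times an argument, namely 2i arctan(Y/x).
-/
theorem tendsto_arg_vertical {x : ℝ} (hx : 0 < x) :
    Tendsto (fun Y : ℝ => Complex.log (x + Y * Complex.I) - Complex.log (x - Y * Complex.I)) atTop
      (𝓝 (Real.pi * Complex.I)) := by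
  have key : ∀ Y : ℝ, Complex.log (x + Y * Complex.I) - Complex.log (x - Y * Complex.I) =
      (2 * Real.arctan (Y / x) : ℝ) * Complex.I := by
    intro Y
    have hconj : (x - Y * Complex.I : ℂ) = (starRingEnd ℂ) (x + Y * Complex.I) := by simp; ring
    have harg : Complex.arg (x + Y * Complex.I) = Real.arctan (Y / x) := by
      rw [Complex.arg_of_re_nonneg (by simpa using hx.le), Real.arctan_eq_arcsin]
      congr 1
      simp only [Complex.add_im, Complex.ofReal_im, Complex.mul_im, Complex.ofReal_re, Complex.I_im,
        Complex.I_re, mul_one, mul_zero, zero_add, add_zero, Complex.norm_add_mul_I]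
      rw [show x ^ 2 + Y ^ 2 = x ^ 2 * (1 + (Y / x) ^ 2) by field_simp,
        Real.sqrt_mul (by positivity), Real.sqrt_sq hx.le, div_div]
    have hne : Complex.arg (x + Y * Complex.I) ≠ Real.pi := by
      rw [harg]; linarith [Real.arctan_lt_pi_div_two (Y / x), Real.pi_pos]
    rw [hconj, Complex.log_conj _ hne, Complex.sub_conj, Complex.log_im, harg]
  simp only [key]
  have h1 : Tendsto (fun Y : ℝ => 2 * Real.arctan (Y / x)) atTop (𝓝 (2 * (Real.pi / 2))) :=
    ((Real.tendsto_arctan_atTop.mono_right nhdsWithin_le_nhds).comp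
      (tendsto_id.atTop_div_const hx)).const_mul 2
  rw [mul_div_cancel₀ _ (two_ne_zero)] at h1
  exact ((Complex.continuous_ofReal.tendsto _).comp h1).mul_const _

/-- A piecewise smooth curve which is a vertical line outside a bounded part. -/
structure IsVerticalContour (C : ℝ → ℂ) : Prop where
  continuous : Continuous C
  smooth : ∃ F : Finset ℝ, ∀ t ∉ F, ContDiffAt ℝ 1 C t
  bounded : ∃ L : ℝ, ∀ t, ‖deriv C t‖ ≤ L
  vertical : ∃ σ T : ℝ, ∀ t : ℝ, T ≤ |t| → C t = σ + t * Complex.I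

theorem IsSeparatingContour.isVerticalContour {C : ℝ → ℂ} {A B : Set ℂ}
    (h : IsSeparatingContour C A B) : IsVerticalContour C :=
  ⟨h.continuous, h.smooth, h.bounded, h.vertical⟩

/-- The integral of `1 / (z - p)` along the part of `C` between the heights `-Y` and `Y`. -/
def winding (C : ℝ → ℂ) (p : ℂ) (Y : ℝ) : ℂ := ∫ t in -Y..Y, (C t - p)⁻¹ * deriv C t

namespace IsVerticalContour
variable {C : ℝ → ℂ} (hC : IsVerticalContour C)
include hC

theorem intervalIntegrable {f : ℝ → ℂ} (hf : Continuous f) (a b : ℝ) :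
    IntervalIntegrable (fun t => f t * deriv C t) volume a b := by
  obtain ⟨L, hL⟩ := hC.bounded
  have h1 : IntervalIntegrable (deriv C) volume a b := by
    rw [intervalIntegrable_iff]
    refine Measure.integrableOn_of_bounded (M := L) (by simp) ?_ ?_
    · exact (measurable_deriv C).aestronglyMeasurable
    · exact Eventually.of_forall hL
  exact h1.continuousOn_mul hf.continuousOn

theorem integral_eq_sub {H h : ℂ → ℂ} (hH : ∀ t, HasDerivAt H (h (C t)) (C t))
    (hh : Continuous fun t => h (C t)) (a b : ℝ) :
    ∫ t in a..b, h (C t) * deriv C t = H (C b) - H (C a) := by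
  obtain ⟨F, hF⟩ := hC.smooth
  refine integral_eq_of_hasDerivAt_off_countable (H ∘ C) _ F.countable_toSet ?_ ?_
    (hC.intervalIntegrable hh a b)
  · intro t _
    exact ((hH t).continuousAt.comp hC.continuous.continuousAt).continuousWithinAt
  · intro t ht
    have hd : HasDerivAt C (deriv C t) t :=
      ((hF t ht.2).differentiableAt (by simp)).hasDerivAt
    exact (hH t).scomp_of_eq t hd rfl |>.congr_deriv (by simp [mul_comm])

theorem exists_abs_re_lt : ∃ M : ℝ, 0 < M ∧ ∀ t, |(C t).re| < M := by
  obtain ⟨σ, T, hT⟩ := hC.vertical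
  obtain ⟨M, hM⟩ := (isCompact_Icc (a := -|T|) (b := |T|)).exists_bound_of_continuousOn
    hC.continuous.continuousOn
  refine ⟨|M| + |σ| + 1, by positivity, fun t => ?_⟩
  rcases le_or_gt |t| |T| with h | h
  · have h1 := hM t (abs_le.mp h)
    have h2 := Complex.abs_re_le_norm (C t)
    have h3 := le_abs_self M
    have h4 := abs_nonneg σ
    linarith
  · rw [hT t ((le_abs_self T).trans h.le)]
    simp
    have := abs_nonneg M
    linarith

theorem tendsto_atTop : Tendsto C atTop (Bornology.cobounded ℂ) := by
  obtain ⟨σ, T, hT⟩ := hC.vertical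
  rw [← tendsto_norm_atTop_iff_cobounded]
  refine tendsto_atTop_mono' _ ?_ tendsto_id
  filter_upwards [eventually_ge_atTop T] with t ht
  have h := Complex.abs_im_le_norm (C t)
  rw [hT t (ht.trans (le_abs_self t))] at h ⊢
  simp only [Complex.add_im, Complex.ofReal_im, Complex.mul_im, Complex.ofReal_re, Complex.I_im,
    Complex.I_re, mul_one, mul_zero, zero_add, add_zero] at h
  exact (le_abs_self t).trans h

theorem tendsto_atBot : Tendsto C atBot (Bornology.cobounded ℂ) := by
  obtain ⟨σ, T, hT⟩ := hC.vertical
  rw [← tendsto_norm_atTop_iff_cobounded]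
  refine tendsto_atTop_mono' _ ?_ tendsto_neg_atBot_atTop
  filter_upwards [eventually_le_atBot (-T)] with t ht
  have h := Complex.abs_im_le_norm (C t)
  have h1 := neg_le_abs t
  rw [hT t (by linarith)] at h ⊢
  simp only [Complex.add_im, Complex.ofReal_im, Complex.mul_im, Complex.ofReal_re, Complex.I_im,
    Complex.I_re, mul_one, mul_zero, zero_add, add_zero] at h
  exact h1.trans h

theorem tendsto_neg_atTop : Tendsto (fun Y => C (-Y)) atTop (Bornology.cobounded ℂ) :=
  hC.tendsto_atBot.comp tendsto_neg_atTop_atBot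

theorem isClosed_range : IsClosed (range C) := by
  refine IsProperMap.isClosed_range ?_
  rw [isProperMap_iff_tendsto_cocompact]
  refine ⟨hC.continuous, ?_⟩
  rw [cocompact_eq_atBot_atTop, ← Metric.cobounded_eq_cocompact]
  exact hC.tendsto_atBot.sup hC.tendsto_atTop

/-- The quotient (z-p)/(z-p') stays within distance less than 1 of 1 along the contour, so its
principal logarithm is a primitive. The quotient tends to 1 at both ends. -/
theorem tendsto_winding_sub_of_near {p p' : ℂ} (h : ∀ t, ‖p - p'‖ < ‖C t - p'‖) :
    Tendsto (fun Y => winding C p Y - winding C p' Y) atTop (𝓝 0) := by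
  have h0' : ∀ t, C t - p' ≠ 0 := fun t ht => by
    have := h t; rw [ht, norm_zero] at this; exact (norm_nonneg _).not_gt this
  have h0 : ∀ t, C t - p ≠ 0 := fun t ht => by
    have := h t; rw [sub_eq_zero.mp ht] at this; exact this.false
  have hr : ∀ t, (C t - p) / (C t - p') = 1 + -((p - p') / (C t - p')) := fun t => by
    field_simp [h0' t]; ring
  have hslit : ∀ t, (C t - p) / (C t - p') ∈ Complex.slitPlane := fun t => by
    rw [hr]
    refine Complex.mem_slitPlane_of_norm_lt_one ?_
    rw [norm_neg, norm_div, div_lt_one ((norm_nonneg _).trans_lt (h t))]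
    exact h t
  have key : ∀ Y, winding C p Y - winding C p' Y =
      Complex.log ((C Y - p) / (C Y - p')) - Complex.log ((C (-Y) - p) / (C (-Y) - p')) := by
    intro Y
    have c : ∀ q, (∀ t, C t - q ≠ 0) → Continuous fun t => (C t - q)⁻¹ := fun q hq =>
      (hC.continuous.sub continuous_const).inv₀ hq
    rw [winding, winding, ← intervalIntegral.integral_sub (hC.intervalIntegrable (c p h0) _ _)
      (hC.intervalIntegrable (c p' h0') _ _)]
    simp only [← sub_mul]
    refine hC.integral_eq_sub (H := fun z => Complex.log ((z - p) / (z - p')))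
      (h := fun z => (z - p)⁻¹ - (z - p')⁻¹) (fun t => ?_) ((c p h0).sub (c p' h0')) (-Y) Y
    have hd : HasDerivAt (fun z : ℂ => (z - p) / (z - p'))
        ((1 * (C t - p') - (C t - p) * 1) / (C t - p') ^ 2) (C t) :=
      ((hasDerivAt_id _).sub_const p).div ((hasDerivAt_id _).sub_const p') (h0' t)
    refine (hd.clog (hslit t)).congr_deriv ?_
    have := h0 t
    have := h0' t
    field_simp
  simp only [key]
  have lim : ∀ u : ℝ → ℂ, Tendsto u atTop (Bornology.cobounded ℂ) →
      Tendsto (fun Y => (p - p') / (u Y - p')) atTop (𝓝 0) := fun u hu => by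
    have h1 : Tendsto (fun Y => u Y - p') atTop (Bornology.cobounded ℂ) := by
      have := (tendsto_add_const_cobounded (-p')).comp hu
      simpa [sub_eq_add_neg, Function.comp_def] using this
    simpa [div_eq_mul_inv] using (tendsto_inv₀_cobounded.comp h1).const_mul (p - p')
  have lim2 : ∀ u : ℝ → ℝ, Tendsto (fun Y => C (u Y)) atTop (Bornology.cobounded ℂ) →
      Tendsto (fun Y => Complex.log ((C (u Y) - p) / (C (u Y) - p'))) atTop (𝓝 0) := fun u hu => by
    have h1 : Tendsto (fun Y => (C (u Y) - p) / (C (u Y) - p')) atTop (𝓝 1) := by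
      simp only [hr]
      simpa using (lim _ hu).neg.const_add 1
    simpa using h1.clog (by simp)
  simpa using (lim2 id hC.tendsto_atTop).sub (lim2 _ hC.tendsto_neg_atTop)

/-- By the local statement, the parameters on a joining path for which the limit is zero form a
clopen subset of the unit interval. The closedness of the contour supplies the local radius. -/
theorem tendsto_winding_sub {p p' : ℂ} (h : JoinedIn (range C)ᶜ p p') :
    Tendsto (fun Y => winding C p Y - winding C p' Y) atTop (𝓝 0) := by
  obtain ⟨γ, hγ⟩ := h
  let S : Set unitInterval :=
    {τ | Tendsto (fun Y => winding C (γ τ) Y - winding C p' Y) atTop (𝓝 0)}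
  have near : ∀ τ, ∀ᶠ τ' in 𝓝 τ,
      Tendsto (fun Y => winding C (γ τ') Y - winding C (γ τ) Y) atTop (𝓝 0) := by
    intro τ
    have hpos : 0 < Metric.infDist (γ τ) (range C) :=
      (hC.isClosed_range.notMem_iff_infDist_pos (range_nonempty C)).mp (hγ τ)
    filter_upwards [γ.continuous.continuousAt (Metric.ball_mem_nhds (γ τ) hpos)] with τ' hτ'
    refine hC.tendsto_winding_sub_of_near fun t => ?_
    rw [← dist_eq_norm, ← dist_eq_norm, dist_comm (C t)]
    exact (Metric.mem_ball.mp hτ').trans_le (Metric.infDist_le_dist_of_mem (mem_range_self t))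
  have hclopen : IsClopen S := by
    constructor
    · rw [← isOpen_compl_iff, isOpen_iff_mem_nhds]
      intro τ hτ
      filter_upwards [near τ] with τ' h1 h2
      refine hτ ?_
      have : Tendsto _ atTop (𝓝 ((0 : ℂ) - 0)) := Tendsto.sub h2 h1
      simpa [S] using this
    · rw [isOpen_iff_mem_nhds]
      intro τ hτ
      filter_upwards [near τ] with τ' h1
      have : Tendsto _ atTop (𝓝 ((0 : ℂ) + 0)) := Tendsto.add h1 hτ
      simpa [S] using this
  have h1 : (1 : unitInterval) ∈ S := by simp [S]
  have h0 : (0 : unitInterval) ∈ S := by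
    rw [hclopen.eq_univ ⟨1, h1⟩]; trivial
  simpa [S] using h0

/-- The point may be moved to a real r beyond the whole contour. There log(r-z) is a primitive, and
its end values on the vertical line give the limit. -/
theorem tendsto_winding_of_right {p : ℂ}
    (hp : ∃ r₀ : ℝ, ∀ r : ℝ, r₀ ≤ r → JoinedIn (range C)ᶜ p (r : ℂ)) :
    Tendsto (winding C p) atTop (𝓝 (-(Real.pi * Complex.I))) := by
  obtain ⟨r₀, hr₀⟩ := hp
  obtain ⟨M, -, hM⟩ := hC.exists_abs_re_lt
  obtain ⟨σ, T, hT⟩ := hC.vertical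
  have hσ : |σ| < M := by
    have := hM |T|
    rw [hT |T| (by rw [abs_abs]; exact le_abs_self T)] at this
    simpa using this
  set r := max r₀ M with hr
  have hMr : M ≤ r := le_max_right _ _
  have h1 := hC.tendsto_winding_sub (hr₀ r (le_max_left _ _))
  have hpos : ∀ t, 0 < ((r : ℂ) - C t).re := fun t => by
    have := (abs_lt.mp (hM t)).2
    simp; linarith
  have h0 : ∀ t, (r : ℂ) - C t ≠ 0 := fun t h => by
    have := hpos t; rw [h] at this; simp at this
  have key : ∀ Y, winding C r Y = Complex.log (r - C Y) - Complex.log (r - C (-Y)) := by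
    intro Y
    refine hC.integral_eq_sub (H := fun z => Complex.log (r - z)) (h := fun z => (z - r)⁻¹)
      (fun t => ?_) ((hC.continuous.sub continuous_const).inv₀ fun t => ?_) (-Y) Y
    · refine (((hasDerivAt_id (C t)).const_sub (r : ℂ)).clog (Or.inl (hpos t))).congr_deriv ?_
      have := h0 t
      rw [← neg_sub (r : ℂ), inv_neg]
      simp [div_eq_mul_inv]
    · rw [← neg_sub]; exact neg_ne_zero.mpr (h0 t)
  have hx : 0 < r - σ := by have := (abs_lt.mp hσ).2; linarith
  have h2 : Tendsto (winding C r) atTop (𝓝 (-(Real.pi * Complex.I))) := by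
    refine (tendsto_arg_vertical hx).neg.congr' ?_
    filter_upwards [eventually_ge_atTop T] with Y hY
    rw [key, hT Y (hY.trans (le_abs_self Y)), hT (-Y) (by rw [abs_neg]; exact hY.trans (le_abs_self Y)),
      neg_sub]
    congr 2 <;> push_cast <;> ring
  simpa using h1.add h2

theorem tendsto_winding_of_left {p : ℂ}
    (hp : ∃ r₀ : ℝ, ∀ r : ℝ, r₀ ≤ r → JoinedIn (range C)ᶜ p ((-r : ℝ) : ℂ)) :
    Tendsto (winding C p) atTop (𝓝 (Real.pi * Complex.I)) := by
  obtain ⟨r₀, hr₀⟩ := hp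
  obtain ⟨M, -, hM⟩ := hC.exists_abs_re_lt
  obtain ⟨σ, T, hT⟩ := hC.vertical
  have hσ : |σ| < M := by
    have := hM |T|
    rw [hT |T| (by rw [abs_abs]; exact le_abs_self T)] at this
    simpa using this
  set r := max r₀ M with hr
  have hMr : M ≤ r := le_max_right _ _
  have h1 := hC.tendsto_winding_sub (hr₀ r (le_max_left _ _))
  have hpos : ∀ t, 0 < (C t + (r : ℂ)).re := fun t => by
    have := (abs_lt.mp (hM t)).1
    simp; linarith
  have h0 : ∀ t, C t + (r : ℂ) ≠ 0 := fun t h => by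
    have := hpos t; rw [h] at this; simp at this
  have key : ∀ Y, winding C ((-r : ℝ) : ℂ) Y = Complex.log (C Y + r) - Complex.log (C (-Y) + r) := by
    intro Y
    rw [winding, show ((-r : ℝ) : ℂ) = -(r : ℂ) by push_cast; ring]
    simp only [sub_neg_eq_add]
    refine hC.integral_eq_sub (H := fun z => Complex.log (z + r)) (h := fun z => (z + r)⁻¹)
      (fun t => ?_) ((hC.continuous.add continuous_const).inv₀ h0) (-Y) Y
    refine (((hasDerivAt_id (C t)).add_const (r : ℂ)).clog (Or.inl (hpos t))).congr_deriv ?_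
    simp [div_eq_mul_inv]
  have hx : 0 < r + σ := by have := (abs_lt.mp hσ).1; linarith
  have h2 : Tendsto (winding C ((-r : ℝ) : ℂ)) atTop (𝓝 (Real.pi * Complex.I)) := by
    refine (tendsto_arg_vertical hx).congr' ?_
    filter_upwards [eventually_ge_atTop T] with Y hY
    rw [key, hT Y (hY.trans (le_abs_self Y)), hT (-Y) (by rw [abs_neg]; exact hY.trans (le_abs_self Y))]
    congr 2 <;> push_cast <;> ring
  simpa using h1.add h2

end IsVerticalContour

/-! ### Shifting a contour by one -/

/-- The Laurent principal part of a meromorphic function at a point. -/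
theorem exists_eq_add_principalPart {p : ℂ} (n : ℕ) {g h : ℂ → ℂ} (hh : AnalyticAt ℂ h p)
    (hg : ∀ᶠ z in 𝓝[≠] p, g z = h z / (z - p) ^ n) :
    ∃ (c : ℕ → ℂ) (k : ℂ → ℂ), AnalyticAt ℂ k p ∧
      ∀ z ≠ p, g z = k z + ∑ j ∈ Finset.range n, c j * ((z - p) ^ (j + 1))⁻¹ := by
  classical
  induction n generalizing g h with
  | zero =>
    -- Only the value at p is repaired: the decomposition then holds everywhere off p, so the
    -- regular part keeps the other poles and the decay of g.
    refine ⟨0, Function.update g p (h p), ?_, fun z hz => by simp [hz]⟩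
    refine hh.congr ?_
    rw [eventually_nhdsWithin_iff] at hg
    filter_upwards [hg] with z hz
    rcases eq_or_ne z p with rfl | hzp
    · simp
    · simpa [hzp] using (hz hzp).symm
  | succ n ih =>
    have h1 : AnalyticAt ℂ (dslope h p) p := by
      have := hh.hasFPowerSeriesAt.has_fpower_series_dslope_fslope
      exact ⟨_, this⟩
    obtain ⟨c, k, hk, hgk⟩ := ih (g := fun z => g z - h p * ((z - p) ^ (n + 1))⁻¹) h1 (by
      filter_upwards [hg, self_mem_nhdsWithin] with z hz hzp
      have hzp : z - p ≠ 0 := sub_ne_zero.mpr hzp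
      rw [hz, dslope_of_ne _ (sub_ne_zero.mp hzp), slope_def_field, pow_succ]
      field_simp)
    refine ⟨fun j => if j = n then h p else c j, k, hk, fun z hz => ?_⟩
    have e : ∑ j ∈ Finset.range n, (if j = n then h p else c j) * ((z - p) ^ (j + 1))⁻¹ =
        ∑ j ∈ Finset.range n, c j * ((z - p) ^ (j + 1))⁻¹ :=
      Finset.sum_congr rfl fun j hj => by rw [if_neg (Finset.mem_range.mp hj).ne]
    simp only [Finset.sum_range_succ, e, if_true]
    linear_combination hgk z hz

namespace IsVerticalContour
variable {C : ℝ → ℂ} (hC : IsVerticalContour C)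
include hC

theorem integral_shift_eq_sub {H h : ℂ → ℂ} (hH : ∀ t, HasDerivAt H (h (C t)) (C t))
    (hH' : ∀ t, HasDerivAt H (h (C t + 1)) (C t + 1))
    (hh : Continuous fun t => h (C t)) (hh' : Continuous fun t => h (C t + 1)) (a b : ℝ) :
    ∫ t in a..b, (h (C t + 1) - h (C t)) * deriv C t =
      (H (C b + 1) - H (C b)) - (H (C a + 1) - H (C a)) := by
  rw [hC.integral_eq_sub (H := fun z => H (z + 1) - H z) (h := fun z => h (z + 1) - h z) ?_
    (hh'.sub hh)]
  intro t
  have := (hH' t).comp_add_const (C t) 1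
  exact this.sub (hH t)

theorem tendsto_integral_shift_pow (p : ℂ) (hp : ∀ t, C t ≠ p) (hp' : ∀ t, C t + 1 ≠ p) (j : ℕ) :
    Tendsto (fun Y => ∫ t in -Y..Y, (((C t + 1 - p) ^ (j + 2))⁻¹ - ((C t - p) ^ (j + 2))⁻¹)
      * deriv C t) atTop (𝓝 0) := by
  have key : ∀ q, q ≠ p → HasDerivAt (fun z : ℂ => -((j + 1 : ℂ))⁻¹ * ((z - p) ^ (j + 1))⁻¹)
      (((q - p) ^ (j + 2))⁻¹) q := by
    intro q hq
    have hq : q - p ≠ 0 := sub_ne_zero.mpr hq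
    have hj : (j + 1 : ℂ) ≠ 0 := by exact_mod_cast j.succ_ne_zero
    have h1 : HasDerivAt (fun z : ℂ => (z - p) ^ (j + 1)) ((j + 1 : ℕ) * (q - p) ^ j * 1) q := by
      simpa using ((hasDerivAt_id q).sub_const p).fun_pow (j + 1)
    refine ((h1.inv (pow_ne_zero _ hq)).const_mul _).congr_deriv ?_
    push_cast
    field_simp
    ring
  have hc : ∀ q, (∀ t, C t ≠ q) → Continuous fun t => ((C t - q) ^ (j + 2))⁻¹ := fun q hq =>
    ((hC.continuous.sub continuous_const).pow _).inv₀ fun t =>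
      pow_ne_zero _ (sub_ne_zero.mpr (hq t))
  have e : ∀ Y : ℝ, _ := fun Y => hC.integral_shift_eq_sub (h := fun z => ((z - p) ^ (j + 2))⁻¹)
    (fun t => key _ (hp t)) (fun t => key _ (hp' t)) (hc p hp)
    (by simpa only [sub_sub_eq_add_sub] using hc (p - 1) fun t h => hp' t (by rw [h]; ring)) (-Y) Y
  simp only [e]
  have lim : ∀ q, ∀ u : ℝ → ℂ, Tendsto u atTop (Bornology.cobounded ℂ) →
      Tendsto (fun Y => -((j + 1 : ℂ))⁻¹ * ((u Y - q) ^ (j + 1))⁻¹) atTop (𝓝 0) := fun q u hu => by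
    have h1 : Tendsto (fun Y => u Y - q) atTop (Bornology.cobounded ℂ) := by
      have := (tendsto_add_const_cobounded (-q)).comp hu
      simpa [sub_eq_add_neg, Function.comp_def] using this
    have h2 := ((tendsto_inv₀_cobounded.comp h1).pow (j + 1)).const_mul (-((j + 1 : ℂ))⁻¹)
    simpa [Function.comp_def] using h2
  have l1 := lim p _ hC.tendsto_atTop
  have l2 := lim p _ hC.tendsto_neg_atTop
  have l3 := lim (p - 1) _ hC.tendsto_atTop
  have l4 := lim (p - 1) _ hC.tendsto_neg_atTop
  simp only [sub_sub_eq_add_sub] at l3 l4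
  simpa using (l3.sub l1).sub (l4.sub l2)

/-- Shifting the contour by one over poles which lie on the same side of both contours. -/
theorem tendsto_integral_shift {M : ℝ} (hM : ∀ t, |(C t).re| + 1 < M) (P : Finset ℂ)
    {g : ℂ → ℂ} (hg : ∀ z, |z.re| < M → z ∉ P → DifferentiableAt ℂ g z)
    (hm : ∀ p ∈ P, MeromorphicAt g p) (hP : ∀ p ∈ P, ∀ t, C t ≠ p ∧ C t + 1 ≠ p)
    (hw : ∀ p ∈ P, Tendsto (fun Y => winding C (p - 1) Y - winding C p Y) atTop (𝓝 0))
    (hd : ∀ ε > 0, ∃ T : ℝ, ∀ z : ℂ, |z.re| < M → T ≤ |z.im| → ‖g z‖ ≤ ε) :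
    Tendsto (fun Y => ∫ t in -Y..Y, (g (C t + 1) - g (C t)) * deriv C t) atTop (𝓝 0) := by
  classical
  have hS : ∀ t, |(C t).re| < M := fun t => by linarith [hM t]
  have hS' : ∀ t, |(C t + 1).re| < M := fun t => by
    have := abs_add_le (C t).re 1
    rw [abs_one] at this
    simpa using this.trans_lt (hM t)
  have hopen : IsOpen {z : ℂ | |z.re| < M} :=
    isOpen_lt (Complex.continuous_re.abs) continuous_const
  induction P using Finset.induction_on generalizing g with
  | empty =>
    have hconv : Convex ℝ {z : ℂ | |z.re| < M} := by
      have : {z : ℂ | |z.re| < M} = Complex.reLm ⁻¹' (Metric.ball 0 M) := by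
        ext z; simp
      rw [this]; exact (convex_ball _ _).linear_preimage _
    -- Without poles there is a primitive H on the convex strip. The integral is the difference of
    -- H(z+1) - H(z) at the two ends, each bounded by the size of g on a horizontal unit segment.
    obtain ⟨H, hH⟩ := hconv.exists_forall_hasDerivWithinAt
      (f := g) fun z hz => (hg z hz (by simp)).differentiableWithinAt
    have hH : ∀ z, |z.re| < M → HasDerivAt H (g z) z := fun z hz =>
      (hH z hz).hasDerivAt (hopen.mem_nhds hz)
    have hcont : ∀ u : ℝ → ℂ, Continuous u → (∀ t, |(u t).re| < M) →
        Continuous fun t => g (u t) := fun u hu hu' => by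
      rw [continuous_iff_continuousAt]
      intro t
      exact ContinuousAt.comp (hg (u t) (hu' t) (by simp)).continuousAt hu.continuousAt
    have e : ∀ Y : ℝ, _ := fun Y => hC.integral_shift_eq_sub (h := g)
      (fun t => hH _ (hS t)) (fun t => hH _ (hS' t)) (hcont _ hC.continuous hS)
      (hcont _ (hC.continuous.add continuous_const) hS') (-Y) Y
    simp only [e]
    obtain ⟨σ, T, hT⟩ := hC.vertical
    have lim : ∀ u : ℝ → ℝ, Tendsto (fun Y => |u Y|) atTop atTop →
        Tendsto (fun Y => H (C (u Y) + 1) - H (C (u Y))) atTop (𝓝 0) := fun u hu => by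
      rw [Metric.tendsto_nhds]
      intro ε hε
      obtain ⟨T', hT'⟩ := hd (ε / 2) (by positivity)
      filter_upwards [hu.eventually_ge_atTop T, hu.eventually_ge_atTop T'] with Y h1 h2
      have hseg : ∀ z ∈ segment ℝ (C (u Y)) (C (u Y) + 1), |z.re| < M ∧ z.im = u Y := by
        intro z hz
        refine ⟨hconv.segment_subset (hS _) (hS' _) hz, ?_⟩
        obtain ⟨a, b, -, -, hab, rfl⟩ := hz
        rw [hT _ h1]
        simp
        linear_combination (u Y) * hab
      have := (convex_segment (𝕜 := ℝ) (C (u Y)) (C (u Y) + 1)).norm_image_sub_le_of_norm_hasDerivWithin_le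
        (f := H) (f' := g) (C := ε / 2) (fun z hz => (hH z (hseg z hz).1).hasDerivWithinAt)
        (fun z hz => hT' z (hseg z hz).1 (by rw [(hseg z hz).2]; exact h2))
        (left_mem_segment ℝ _ _) (right_mem_segment ℝ _ _)
      rw [dist_zero_right]
      simp at this
      linarith
    simpa using (lim id tendsto_abs_atTop_atTop).sub
      (lim Neg.neg (by simp only [abs_neg]; exact tendsto_abs_atTop_atTop))
  | insert p P hpP ih =>
    -- One pole is removed by subtracting its principal part. The simple term contributes a
    -- difference of two windings, and higher powers have primitives tending to zero.
    obtain ⟨n, hn⟩ := hm p (Finset.mem_insert_self p P)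
    obtain ⟨c, k, hk, hgk⟩ := exists_eq_add_principalPart (g := g) n hn (by
      filter_upwards [self_mem_nhdsWithin] with z hz
      have hz : z - p ≠ 0 := sub_ne_zero.mpr hz
      rw [smul_eq_mul]; field_simp)
    set q : ℂ → ℂ := fun z => ∑ j ∈ Finset.range n, c j * ((z - p) ^ (j + 1))⁻¹ with hq
    have hq' : ∀ z ≠ p, AnalyticAt ℂ q z := fun z hz => by
      have hz : z - p ≠ 0 := sub_ne_zero.mpr hz
      refine Finset.analyticAt_fun_sum _ fun j _ => ?_
      refine analyticAt_const.mul (AnalyticAt.inv (by fun_prop) (pow_ne_zero _ hz))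
    have hev : ∀ z ≠ p, k =ᶠ[𝓝 z] fun w => g w - q w := fun z hz => by
      filter_upwards [isOpen_ne.mem_nhds hz] with w hw
      rw [hgk w hw]; ring
    have hp := hP p (Finset.mem_insert_self p P)
    have IH := ih (g := k)
      (fun z hz hzP => by
        rcases eq_or_ne z p with rfl | hzp
        · exact hk.differentiableAt
        · refine DifferentiableAt.congr_of_eventuallyEq ?_ (hev z hzp)
          exact (hg z hz (by simp [hzp, hzP])).sub (hq' z hzp).differentiableAt)
      (fun z hz => by
        have hzp : z ≠ p := fun h => hpP (h ▸ hz)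
        refine ((hm z (Finset.mem_insert_of_mem hz)).sub (hq' z hzp).meromorphicAt).congr ?_
        exact ((hev z hzp).filter_mono nhdsWithin_le_nhds).symm)
      (fun z hz => hP z (Finset.mem_insert_of_mem hz))
      (fun z hz => hw z (Finset.mem_insert_of_mem hz))
      (fun ε hε => by
        obtain ⟨T, hT⟩ := hd (ε / 2) (by positivity)
        have hlim : Tendsto q (Bornology.cobounded ℂ) (𝓝 0) := by
          have h1 : Tendsto (fun z => z - p) (Bornology.cobounded ℂ) (Bornology.cobounded ℂ) := by
            simp [sub_eq_add_neg]
          have : Tendsto q (Bornology.cobounded ℂ) (𝓝 (∑ j ∈ Finset.range n, c j * 0 ^ (j + 1))) :=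
            tendsto_finsetSum _ fun j _ => by
              simpa [Function.comp_def] using
                ((tendsto_inv₀_cobounded.comp h1).pow (j + 1)).const_mul (c j)
          simpa using this
        have h2 := (Metric.tendsto_nhds.mp hlim) (ε / 2) (by positivity)
        rw [← comap_norm_atTop, eventually_comap] at h2
        obtain ⟨T', hT'⟩ := eventually_atTop.mp h2
        refine ⟨max (max T T') (|p.im| + 1), fun z hz hzT => ?_⟩
        have hzp : z ≠ p := fun h => by
          have := (le_max_right _ _).trans hzT
          rw [h] at this; linarith
        have e1 := hT z hz ((le_max_left _ _).trans ((le_max_left _ _).trans hzT))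
        have e2 := hT' ‖z‖ (((le_max_right _ _).trans ((le_max_left _ _).trans hzT)).trans
          (Complex.abs_im_le_norm z)) z rfl
        rw [dist_zero_right] at e2
        have e3 : k z = g z - q z := by rw [hgk z hzp]; ring
        rw [e3]
        linarith [norm_sub_le (g z) (q z)])
    have lim : Tendsto (fun Y => ∑ j ∈ Finset.range n, c j * ∫ t in -Y..Y,
        (((C t + 1 - p) ^ (j + 1))⁻¹ - ((C t - p) ^ (j + 1))⁻¹) * deriv C t) atTop (𝓝 0) := by
      have : Tendsto (fun Y => ∑ j ∈ Finset.range n, c j * ∫ t in -Y..Y,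
        (((C t + 1 - p) ^ (j + 1))⁻¹ - ((C t - p) ^ (j + 1))⁻¹) * deriv C t) atTop
        (𝓝 (∑ j ∈ Finset.range n, c j * 0)) := by
        refine tendsto_finsetSum _ fun j _ => Tendsto.const_mul _ ?_
        cases j with
        | zero =>
          refine (hw p (Finset.mem_insert_self p P)).congr fun Y => ?_
          rw [winding, winding, ← intervalIntegral.integral_sub]
          · refine intervalIntegral.integral_congr fun t _ => ?_
            simp only [zero_add, pow_one, sub_mul, sub_sub_eq_add_sub]
          · refine hC.intervalIntegrable ((hC.continuous.sub continuous_const).inv₀ fun t h => ?_) _ _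
            have h : C t - (p - 1) = 0 := h
            exact (hp t).2 (by linear_combination h)
          · refine hC.intervalIntegrable ((hC.continuous.sub continuous_const).inv₀ fun t h => ?_) _ _
            have h : C t - p = 0 := h
            exact (hp t).1 (by linear_combination h)
        | succ j =>
          exact hC.tendsto_integral_shift_pow p (fun t => (hp t).1) (fun t => (hp t).2) j
      simpa using this
    have hcq : ∀ j, Continuous fun t => ((C t + 1 - p) ^ (j + 1))⁻¹ - ((C t - p) ^ (j + 1))⁻¹ :=
      fun j => (((hC.continuous.add continuous_const).sub continuous_const).pow _ |>.inv₀ fun t =>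
        pow_ne_zero _ (sub_ne_zero.mpr (hp t).2)).sub
        (((hC.continuous.sub continuous_const).pow _).inv₀ fun t =>
        pow_ne_zero _ (sub_ne_zero.mpr (hp t).1))
    have hcg : ∀ u : ℝ → ℂ, Continuous u → (∀ t, |(u t).re| < M) → (∀ p' ∈ insert p P, ∀ t, u t ≠ p') →
        Continuous fun t => k (u t) := fun u hu hu' hup => by
      rw [continuous_iff_continuousAt]
      intro t
      have h1 : ∀ p' ∈ insert p P, u t ≠ p' := fun p' hp' => hup p' hp' t
      refine ContinuousAt.comp (g := k) ?_ hu.continuousAt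
      refine ContinuousAt.congr ?_ (hev _ (h1 p (Finset.mem_insert_self p P))).symm
      exact (hg _ (hu' t) fun h => h1 _ h rfl).continuousAt.sub
        (hq' _ (h1 p (Finset.mem_insert_self p P))).continuousAt
    have e : ∀ Y : ℝ, (∫ t in -Y..Y, (g (C t + 1) - g (C t)) * deriv C t) =
        (∫ t in -Y..Y, (k (C t + 1) - k (C t)) * deriv C t) +
        ∑ j ∈ Finset.range n, c j * ∫ t in -Y..Y,
          (((C t + 1 - p) ^ (j + 1))⁻¹ - ((C t - p) ^ (j + 1))⁻¹) * deriv C t := by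
      intro Y
      simp only [← intervalIntegral.integral_const_mul]
      rw [← intervalIntegral.integral_finsetSum, ← intervalIntegral.integral_add]
      · refine intervalIntegral.integral_congr fun t _ => ?_
        rw [hgk _ (hp t).1, hgk _ (hp t).2]
        simp only [sub_mul, mul_sub, add_mul, Finset.sum_sub_distrib, Finset.sum_mul, mul_assoc]
        ring
      · exact hC.intervalIntegrable ((hcg _ (hC.continuous.add continuous_const) hS'
          fun p' hp' t => (hP p' hp' t).2).sub (hcg _ hC.continuous hS
          fun p' hp' t => (hP p' hp' t).1)) _ _
      · rw [show (fun t => ∑ j ∈ Finset.range n, c j * ((((C t + 1 - p) ^ (j + 1))⁻¹ -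
          ((C t - p) ^ (j + 1))⁻¹) * deriv C t)) = fun t => (∑ j ∈ Finset.range n,
          c j * (((C t + 1 - p) ^ (j + 1))⁻¹ - ((C t - p) ^ (j + 1))⁻¹)) * deriv C t by
            funext t; simp only [Finset.sum_mul, mul_assoc]]
        exact hC.intervalIntegrable
          (continuous_finsetSum _ fun j _ => continuous_const.mul (hcq j)) _ _
      · exact fun j _ => (hC.intervalIntegrable (hcq j) _ _).const_mul _
    simp only [e]
    simpa using IH.add lim

end IsVerticalContour

/-! ### Existence of a separating contour -/

/-- A coincidence between p and q with distinct real parts excludes one slope ε, and there are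
countably many pairs. Equal real parts would force p = q. -/
theorem exists_shear_separating {A B : Set ℂ} (hA : A.Countable) (hB : B.Countable)
    (hAB : Disjoint A B) :
    ∃ ε : ℝ, ∀ p ∈ A, ∀ q ∈ B, p.im + ε * p.re ≠ q.im + ε * q.re := by
  have hc : ((fun x : ℂ × ℂ => -(x.1.im - x.2.im) / (x.1.re - x.2.re)) '' (A ×ˢ B)).Countable :=
    (hA.prod hB).image _
  obtain ⟨ε, hε⟩ := (hc.dense_compl ℝ).nonempty
  refine ⟨ε, fun p hp q hq h => hε ⟨(p, q), ⟨hp, hq⟩, ?_⟩⟩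
  have hre : p.re - q.re ≠ 0 := fun h0 => by
    have h0 : p.re = q.re := sub_eq_zero.mp h0
    rw [h0] at h
    exact disjoint_left.mp hAB hp (by rwa [Complex.ext h0 (add_right_cancel h)])
  simp only
  rw [div_eq_iff hre]
  linear_combination -h

/-- A compactly supported smooth function with prescribed values `-m` and `m` on two finite sets. -/
theorem exists_contDiff_interpolation {S S' : Set ℝ} (hS : S.Finite) (hS' : S'.Finite)
    (hd : Disjoint S S') {m : ℝ} (hm : 0 ≤ m) :
    ∃ φ : ℝ → ℝ, ContDiff ℝ 1 φ ∧ (∃ T, ∀ t, T ≤ |t| → φ t = 0) ∧ (∀ t, |φ t| ≤ m) ∧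
      (∀ t ∈ S, φ t = -m) ∧ ∀ t ∈ S', φ t = m := by
  obtain ⟨T, hT⟩ := (hS.union hS').isBounded.exists_norm_le
  have key : ∀ U V : Set ℝ, U.Finite → V.Finite → Disjoint U V → (∀ t ∈ V, |t| ≤ T) →
      ∃ g : ℝ → ℝ, ContDiff ℝ 1 g ∧ (∀ t, T + 1 ≤ |t| → g t = 0) ∧ (∀ t ∈ U, g t = 0) ∧
        (∀ t ∈ V, g t = 1) ∧ ∀ t, g t ∈ Icc (0 : ℝ) 1 := by
    intro U V hU hV hUV hVT
    have hcl : IsClosed ({t : ℝ | T + 1 ≤ |t|} ∪ U) :=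
      (isClosed_le continuous_const continuous_abs).union hU.isClosed
    have hdis : Disjoint ({t : ℝ | T + 1 ≤ |t|} ∪ U) V := by
      refine disjoint_union_left.mpr ⟨disjoint_left.mpr fun t ht htV => ?_, hUV⟩
      have := hVT t htV
      have ht : T + 1 ≤ |t| := ht
      linarith
    obtain ⟨f, h0, h1, h01⟩ := exists_contMDiffMap_zero_one_of_isClosed (n := 1)
      (modelWithCornersSelf ℝ ℝ) hcl hV.isClosed hdis
    exact ⟨f, f.contMDiff.contDiff, fun t ht => h0 (Or.inl ht), fun t ht => h0 (Or.inr ht),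
      fun t ht => h1 ht, h01⟩
  obtain ⟨f, f1, f2, f3, f4, f5⟩ := key S' S hS' hS hd.symm fun t ht => hT t (Or.inl ht)
  obtain ⟨g, g1, g2, g3, g4, g5⟩ := key S S' hS hS' hd fun t ht => hT t (Or.inr ht)
  refine ⟨fun t => m * (g t - f t), contDiff_const.mul (g1.sub f1),
    ⟨T + 1, fun t ht => by simp [f2 t ht, g2 t ht]⟩, fun t => ?_,
    fun t ht => by simp [g3 t ht, f4 t ht], fun t ht => by simp [f3 t ht, g4 t ht]⟩
  rw [abs_mul, abs_of_nonneg hm]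
  refine mul_le_of_le_one_right hm (abs_le.mpr ⟨?_, ?_⟩) <;>
    linarith [(f5 t).1, (f5 t).2, (g5 t).1, (g5 t).2]

/-- In the sheared coordinate τ = im + ε re, the contour is a graph re = φ(τ). No two points of A
and B share a τ, so φ can be pushed left at the finitely many relevant points of A and right at
those of B. -/
theorem exists_isSeparatingContour {A B : Set ℂ} (hA : A.Countable) (hB : B.Countable)
    (hAB : Disjoint A B) (hAf : ∀ M : ℝ, {z ∈ A | z.re ≤ M}.Finite)
    (hBf : ∀ M : ℝ, {z ∈ B | -M ≤ z.re}.Finite) : ∃ C, IsSeparatingContour C A B := by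
  obtain ⟨ε, hε⟩ := exists_shear_separating hA hB hAB
  obtain ⟨m₀, hm₀⟩ := ((hAf 1).union (hBf 1)).isBounded.exists_norm_le
  -- So large that -m lies left of every point of A and m right of every point of B where φ is
  -- prescribed.
  set m := |m₀| + 1 with hm
  have hmpos : 1 ≤ m := by have := abs_nonneg m₀; linarith
  let τ : ℂ → ℝ := fun z => z.im + ε * z.re
  obtain ⟨φ, hφ, ⟨T, hT⟩, hφm, hφA, hφB⟩ := exists_contDiff_interpolation (m := m)
    ((hAf m).image τ) ((hBf m).image τ) (by
      rw [disjoint_left]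
      rintro _ ⟨p, hp, rfl⟩ ⟨q, hq, h⟩
      exact hε p hp.1 q hq.1 h.symm) (by linarith)
  have hsmall : ∀ z, (z ∈ A ∧ z.re ≤ 1) ∨ (z ∈ B ∧ -1 ≤ z.re) → |z.re| < m := fun z hz => by
    have := hm₀ z hz
    have h2 := Complex.abs_re_le_norm z
    have h3 := le_abs_self m₀
    linarith
  have hAr : ∀ p ∈ A, φ (τ p) < p.re := fun p hp => by
    rcases le_or_gt p.re m with h | h
    · rw [hφA _ ⟨p, ⟨hp, h⟩, rfl⟩]
      rcases le_or_gt p.re 1 with h1 | h1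
      · exact (abs_lt.mp (hsmall p (Or.inl ⟨hp, h1⟩))).1
      · linarith
    · exact ((abs_le.mp (hφm _)).2).trans_lt h
  have hBl : ∀ p ∈ B, p.re < φ (τ p) := fun p hp => by
    rcases le_or_gt (-m) p.re with h | h
    · rw [hφB _ ⟨p, ⟨hp, h⟩, rfl⟩]
      rcases le_or_gt (-1) p.re with h1 | h1
      · exact (abs_lt.mp (hsmall p (Or.inr ⟨hp, h1⟩))).2
      · linarith
    · exact h.trans_le ((abs_le.mp (hφm _)).1)
  set C : ℝ → ℂ := fun t => φ t + (t - ε * φ t) * Complex.I with hCdef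
  have hCre : ∀ t, (C t).re = φ t := fun t => by simp [hCdef]
  have hCτ : ∀ t, τ (C t) = t := fun t => by simp [hCdef, τ]
  have hrange : ∀ z, z.re ≠ φ (τ z) → z ∈ (range C)ᶜ := by
    rintro _ h ⟨t, rfl⟩
    rw [hCτ, hCre] at h
    exact h rfl
  have hCd : ContDiff ℝ 1 C := by
    have h1 : ContDiff ℝ 1 fun t => (φ t : ℂ) := Complex.ofRealCLM.contDiff.comp hφ
    have h2 : ContDiff ℝ 1 fun t : ℝ => (t : ℂ) := Complex.ofRealCLM.contDiff
    exact h1.add ((h2.sub (contDiff_const.mul h1)).mul contDiff_const)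
  have hvert : ∀ t : ℝ, T ≤ |t| → C t = (0 : ℝ) + t * Complex.I := fun t ht => by
    simp [hCdef, hT t ht]
  refine ⟨C, hCd.continuous, ⟨∅, fun t _ => hCd.contDiffAt⟩, ?_, ⟨0, T, hvert⟩, ?_, ?_⟩
  · obtain ⟨L, hL⟩ := (isCompact_Icc (a := -T) (b := T)).exists_bound_of_continuousOn
      (hCd.continuous_deriv le_rfl).continuousOn
    refine ⟨max L 1, fun t => ?_⟩
    rcases le_or_gt |t| T with h | h
    · exact (hL t (abs_le.mp h)).trans (le_max_left _ _)
    · have hev : C =ᶠ[𝓝 t] fun t => ((0 : ℝ) : ℂ) + t * Complex.I := by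
        filter_upwards [(isOpen_lt continuous_const continuous_abs).mem_nhds h] with s hs
        exact hvert s (le_of_lt hs)
      have hd : HasDerivAt (fun t : ℝ => ((0 : ℝ) : ℂ) + t * Complex.I) (1 * Complex.I) t :=
        (Complex.ofRealCLM.hasDerivAt.mul_const Complex.I).const_add _
      rw [hev.deriv_eq, hd.deriv]
      simp
  · intro p hp
    refine ⟨m + 1, fun r hr => ?_⟩
    set L := |p.re| + m + 1 with hL
    have hLpos : 0 ≤ L := by positivity
    -- The direction 1 - εi keeps τ constant, so p moves away from the graph until its real part
    -- exceeds m; from there a segment in a half plane suffices.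
    refine JoinedIn.trans (y := p + L * (1 - ε * Complex.I))
      (JoinedIn.of_segment_subset ?_) (JoinedIn.of_segment_subset ?_)
    · rw [segment_eq_image']
      rintro _ ⟨s, hs, rfl⟩
      refine hrange _ (ne_of_gt ?_)
      have e1 : τ (p + s • (p + L * (1 - ε * Complex.I) - p)) = τ p := by simp [τ]; ring
      have e2 : (p + s • (p + L * (1 - ε * Complex.I) - p)).re = p.re + s * L := by simp
      simp only [e1, e2]
      have := mul_nonneg hs.1 hLpos
      linarith [hAr p hp]
    · refine (show Convex ℝ {z : ℂ | m + 1 ≤ z.re} from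
        convex_halfSpace_ge (𝕜 := ℝ) Complex.reLm.isLinear (m + 1)).segment_subset ?_ ?_ |>.trans ?_
      · have := neg_abs_le p.re
        simp; linarith
      · simpa using hr
      · intro z hz
        have hz : m + 1 ≤ z.re := hz
        exact hrange z (by have := (abs_le.mp (hφm (τ z))).2; intro h; linarith)
  · intro p hp
    refine ⟨m + 1, fun r hr => ?_⟩
    set L := |p.re| + m + 1 with hL
    have hLpos : 0 ≤ L := by positivity
    refine JoinedIn.trans (y := p - L * (1 - ε * Complex.I))
      (JoinedIn.of_segment_subset ?_) (JoinedIn.of_segment_subset ?_)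
    · rw [segment_eq_image']
      rintro _ ⟨s, hs, rfl⟩
      refine hrange _ (ne_of_lt ?_)
      have e1 : τ (p + s • (p - L * (1 - ε * Complex.I) - p)) = τ p := by simp [τ]; ring
      have e2 : (p + s • (p - L * (1 - ε * Complex.I) - p)).re = p.re - s * L := by simp; ring
      simp only [e1, e2]
      have := mul_nonneg hs.1 hLpos
      linarith [hBl p hp]
    · refine (show Convex ℝ {z : ℂ | z.re ≤ -(m + 1)} from
        convex_halfSpace_le (𝕜 := ℝ) Complex.reLm.isLinear (-(m + 1))).segment_subset ?_ ?_ |>.trans ?_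
      · have := le_abs_self p.re
        simp; linarith
      · simp; linarith
      · intro z hz
        have hz : z.re ≤ -(m + 1) := hz
        exact hrange z (by have := (abs_le.mp (hφm (τ z))).1; intro h; linarith)

/-! ### Decay along vertical strips -/

/-- Decay faster than any power of the imaginary part, on every vertical strip. -/
def RapidDecay (f : ℂ → ℂ) : Prop :=
  ∀ (R : ℝ) (n : ℕ), ∃ K T : ℝ, ∀ z : ℂ, |z.re| ≤ R → T ≤ |z.im| → ‖f z‖ * |z.im| ^ n ≤ K

theorem norm_Gamma_le {z : ℂ} (hz : 0 < z.re) : ‖Complex.Gamma z‖ ≤ Real.Gamma z.re := by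
  rw [Complex.Gamma_eq_integral hz, Real.Gamma_eq_integral hz, Complex.GammaIntegral]
  refine (norm_integral_le_integral_norm _).trans_eq ?_
  refine setIntegral_congr_fun measurableSet_Ioi fun x hx => ?_
  have hx : 0 < x := hx
  simp only [norm_mul]
  rw [Complex.norm_cpow_eq_rpow_re_of_pos hx, Complex.norm_of_nonneg (Real.exp_pos _).le]
  simp

theorem Gamma_add_natCast {z : ℂ} {n : ℕ} (h : ∀ j < n, z + j ≠ 0) :
    Complex.Gamma (z + n) = poch z n * Complex.Gamma z := by
  induction n with
  | zero => simp [poch_zero]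
  | succ n ih =>
    rw [Nat.cast_succ, ← add_assoc, Complex.Gamma_add_one _ (h n (Nat.lt_succ_self n)),
      ih fun j hj => h j (hj.trans (Nat.lt_succ_self n)), poch_succ]
    ring

/-- Γ(w) = Γ(w+k)/(w)_k: the numerator is bounded on strips in the right half plane, and each factor
of (w)_k is at least |Im z|/2. -/
theorem rapidDecay_Gamma_add (a : ℂ) : RapidDecay fun z => Complex.Gamma (a + z) := by
  intro R n
  -- M shifts bring the real part to at least 1, and n further shifts provide the power of decay.
  obtain ⟨M, hM⟩ := exists_nat_gt (R + |a.re| + 1)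
  obtain ⟨K, hK⟩ := (isCompact_Icc (a := (1 : ℝ)) (b := R + |a.re| + (M + n : ℕ))
    ).exists_bound_of_continuousOn (f := Real.Gamma) fun x hx =>
      (Real.differentiableAt_Gamma fun m => by
        have : (0 : ℝ) ≤ m := m.cast_nonneg
        linarith [hx.1]).continuousAt.continuousWithinAt
  refine ⟨K * 2 ^ (M + n), max (2 * |a.im|) 1, fun z hz hT => ?_⟩
  have h1 : 1 ≤ |z.im| := (le_max_right _ _).trans hT
  have h2 : 2 * |a.im| ≤ |z.im| := (le_max_left _ _).trans hT
  have him : |z.im| / 2 ≤ |(a + z).im| := by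
    have := abs_sub_abs_le_abs_sub z.im (-a.im)
    rw [abs_neg, sub_neg_eq_add, add_comm z.im] at this
    rw [Complex.add_im]; linarith
  have hj : ∀ j : ℕ, |z.im| / 2 ≤ ‖a + z + j‖ := fun j => by
    have := Complex.abs_im_le_norm (a + z + j)
    rw [Complex.add_im _ (j : ℂ), Complex.natCast_im, add_zero] at this
    exact him.trans this
  have hpos : 0 < |z.im| / 2 := by linarith
  have hprod : (|z.im| / 2) ^ (M + n) ≤ ‖poch (a + z) (M + n)‖ := by
    rw [poch_eq_prod, norm_prod]
    calc (|z.im| / 2) ^ (M + n) = ∏ _j ∈ Finset.range (M + n), (|z.im| / 2) := by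
          rw [Finset.prod_const, Finset.card_range]
      _ ≤ _ := Finset.prod_le_prod (fun _ _ => hpos.le) fun j _ => hj j
  have hre := abs_le.mp hz
  have hare := abs_le.mp (le_refl |a.re|)
  have hn0 : (0 : ℝ) ≤ n := n.cast_nonneg
  have hGM : ‖Complex.Gamma (a + z + (M + n : ℕ))‖ ≤ K := by
    have hr : (a + z + (M + n : ℕ)).re = a.re + z.re + (M + n : ℕ) := by simp
    have hr1 : 1 ≤ a.re + z.re + (M + n : ℕ) := by push_cast; linarith
    refine (norm_Gamma_le (by rw [hr]; linarith)).trans ?_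
    rw [hr]
    exact (le_abs_self _).trans (hK _ ⟨hr1, by linarith⟩)
  rw [Gamma_add_natCast fun j _ => norm_pos_iff.mp (hpos.trans_le (hj j)), norm_mul] at hGM
  have h3 : |z.im| ^ n ≤ |z.im| ^ (M + n) := pow_le_pow_right₀ h1 (by omega)
  calc ‖Complex.Gamma (a + z)‖ * |z.im| ^ n
      ≤ ‖Complex.Gamma (a + z)‖ * |z.im| ^ (M + n) := by gcongr
    _ = ((|z.im| / 2) ^ (M + n) * ‖Complex.Gamma (a + z)‖) * 2 ^ (M + n) := by
        rw [div_pow, mul_right_comm, div_mul_cancel₀ _ (by positivity), mul_comm]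
    _ ≤ (‖poch (a + z) (M + n)‖ * ‖Complex.Gamma (a + z)‖) * 2 ^ (M + n) := by gcongr
    _ ≤ K * 2 ^ (M + n) := by gcongr

theorem rapidDecay_Gamma_sub (a : ℂ) : RapidDecay fun z => Complex.Gamma (a - z) := by
  intro R n
  obtain ⟨K, T, h⟩ := rapidDecay_Gamma_add a R n
  refine ⟨K, T, fun z hz hT => ?_⟩
  simpa [sub_eq_add_neg] using h (-z) (by simpa using hz) (by simpa using hT)

theorem RapidDecay.mul_bounded {f g : ℂ → ℂ} (hf : RapidDecay f)
    (hg : ∀ R : ℝ, ∃ K T : ℝ, ∀ z : ℂ, |z.re| ≤ R → T ≤ |z.im| → ‖g z‖ ≤ K) :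
    RapidDecay fun z => f z * g z := by
  intro R n
  obtain ⟨K, T, h⟩ := hf R n
  obtain ⟨K', T', h'⟩ := hg R
  refine ⟨K * K', max T T', fun z hz hT => ?_⟩
  have h1 := h z hz ((le_max_left _ _).trans hT)
  have h2 := h' z hz ((le_max_right _ _).trans hT)
  rw [norm_mul]
  calc ‖f z‖ * ‖g z‖ * |z.im| ^ n = (‖f z‖ * |z.im| ^ n) * ‖g z‖ := by ring
    _ ≤ K * K' := mul_le_mul h1 h2 (norm_nonneg _) (le_trans (by positivity) h1)

theorem RapidDecay.mul {f g : ℂ → ℂ} (hf : RapidDecay f) (hg : RapidDecay g) :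
    RapidDecay fun z => f z * g z :=
  hf.mul_bounded fun R => by simpa using hg R 0

theorem RapidDecay.mul_self {f : ℂ → ℂ} (hf : RapidDecay f) : RapidDecay fun z => f z * z := by
  intro R n
  obtain ⟨K, T, h⟩ := hf R (n + 1)
  refine ⟨K * (|R| + 1), max T 1, fun z hz hT => ?_⟩
  have h1 := h z hz ((le_max_left _ _).trans hT)
  have h2 : 1 ≤ |z.im| := (le_max_right _ _).trans hT
  have h3 : ‖z‖ ≤ (|R| + 1) * |z.im| := by
    have := Complex.norm_le_abs_re_add_abs_im z
    have := le_mul_of_one_le_right (abs_nonneg R) h2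
    linarith [le_abs_self R]
  rw [norm_mul]
  calc ‖f z‖ * ‖z‖ * |z.im| ^ n ≤ ‖f z‖ * ((|R| + 1) * |z.im|) * |z.im| ^ n := by gcongr
    _ = (‖f z‖ * |z.im| ^ (n + 1)) * (|R| + 1) := by ring
    _ ≤ K * (|R| + 1) := by gcongr

theorem RapidDecay.add {f g : ℂ → ℂ} (hf : RapidDecay f) (hg : RapidDecay g) :
    RapidDecay fun z => f z + g z := by
  intro R n
  obtain ⟨K, T, h⟩ := hf R n
  obtain ⟨K', T', h'⟩ := hg R n
  refine ⟨K + K', max T T', fun z hz hT => ?_⟩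
  have h1 := h z hz ((le_max_left _ _).trans hT)
  have h2 := h' z hz ((le_max_right _ _).trans hT)
  have h3 : 0 ≤ |z.im| ^ n := by positivity
  have := mul_le_mul_of_nonneg_right (norm_add_le (f z) (g z)) h3
  linarith

theorem RapidDecay.mul_eval {f : ℂ → ℂ} (hf : RapidDecay f) (p : Polynomial ℂ) :
    RapidDecay fun z => f z * p.eval z := by
  induction p using Polynomial.induction_on' with
  | add p q hp hq => simpa only [Polynomial.eval_add, mul_add] using hp.add hq
  | monomial n a =>
    simp only [Polynomial.eval_monomial]
    induction n with
    | zero => exact hf.mul_bounded fun R => ⟨‖a‖, 0, fun z _ _ => by simp⟩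
    | succ n ih =>
      have := ih.mul_self
      simpa only [pow_succ, mul_assoc] using this

theorem RapidDecay.exists_norm_le {f : ℂ → ℂ} (hf : RapidDecay f) (R : ℝ) {ε : ℝ} (hε : 0 < ε) :
    ∃ T : ℝ, ∀ z : ℂ, |z.re| ≤ R → T ≤ |z.im| → ‖f z‖ ≤ ε := by
  obtain ⟨K, T, h⟩ := hf R 1
  refine ⟨max T (max 1 (K / ε)), fun z hz hT => ?_⟩
  have h1 := h z hz ((le_max_left _ _).trans hT)
  have h2 : 1 ≤ |z.im| := ((le_max_left _ _).trans (le_max_right _ _)).trans hT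
  have h3 : K / ε ≤ |z.im| := ((le_max_right _ _).trans (le_max_right _ _)).trans hT
  rw [div_le_iff₀ hε] at h3
  rw [pow_one] at h1
  have : 0 < |z.im| := by linarith
  by_contra! h4
  have := mul_lt_mul_of_pos_right h4 this
  linarith

/-! ### The cotangent and regularity of Gamma -/

/-- With y = Im w, the cosine is at most (e^y + e^{-y})/2 and the sine at least |e^y - e^{-y}|/2 in
modulus. -/
theorem norm_cot_le {w : ℂ} (hw : 1 ≤ |w.im|) : ‖Complex.cos w / Complex.sin w‖ ≤ 2 := by
  have e1 : ‖Complex.exp (w * Complex.I)‖ = Real.exp (-w.im) := by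
    rw [Complex.norm_exp]; simp
  have e2 : ‖Complex.exp (-w * Complex.I)‖ = Real.exp w.im := by
    rw [Complex.norm_exp]; simp
  have hcos : ‖Complex.cos w‖ ≤ (Real.exp w.im + Real.exp (-w.im)) / 2 := by
    rw [Complex.cos, norm_div, Complex.norm_ofNat]
    have := norm_add_le (Complex.exp (w * Complex.I)) (Complex.exp (-w * Complex.I))
    rw [e1, e2] at this
    linarith
  have hsin : |Real.exp w.im - Real.exp (-w.im)| / 2 ≤ ‖Complex.sin w‖ := by
    rw [Complex.sin, norm_div, norm_mul, Complex.norm_I, mul_one, Complex.norm_ofNat]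
    have := abs_norm_sub_norm_le (Complex.exp (-w * Complex.I)) (Complex.exp (w * Complex.I))
    rw [e1, e2] at this
    linarith
  have key : ∀ y : ℝ, 1 ≤ y → Real.exp y + Real.exp (-y) ≤ 2 * (Real.exp y - Real.exp (-y)) := by
    intro y hy
    have h1 : Real.exp y * Real.exp (-y) = 1 := by rw [← Real.exp_add]; simp
    have h2 := Real.add_one_le_exp y
    have h3 := Real.exp_pos (-y)
    nlinarith
  rw [norm_div]
  refine div_le_of_le_mul₀ (norm_nonneg _) (by norm_num) ?_
  refine hcos.trans (le_trans ?_ (mul_le_mul_of_nonneg_left hsin (by norm_num)))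
  rcases le_abs.mp hw with h | h
  · have h1 := key _ h
    have h2 := le_abs_self (Real.exp w.im - Real.exp (-w.im))
    linarith
  · have h1 := key _ h
    rw [neg_neg] at h1
    have h2 := neg_abs_le (Real.exp w.im - Real.exp (-w.im))
    linarith

/-- The function `cot (π z)`. -/
def piCot (z : ℂ) : ℂ := Complex.cos (Real.pi * z) / Complex.sin (Real.pi * z)

theorem norm_piCot_le {z : ℂ} (hz : 1 ≤ |z.im|) : ‖piCot z‖ ≤ 2 := by
  refine norm_cot_le ?_
  rw [Complex.im_ofReal_mul, abs_mul, abs_of_pos Real.pi_pos]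
  nlinarith [Real.pi_gt_three]

theorem piCot_add_one (z : ℂ) : piCot (z + 1) = piCot z := by
  rw [piCot, mul_add, mul_one, Complex.cos_add_pi, Complex.sin_add_pi, neg_div_neg_eq, piCot]

theorem sin_pi_mul_ne_zero {z : ℂ} (hz : ∀ k : ℤ, z ≠ k) : Complex.sin (Real.pi * z) ≠ 0 := by
  rw [Ne, Complex.sin_eq_zero_iff]
  rintro ⟨k, hk⟩
  refine hz k ?_
  have : (Real.pi : ℂ) ≠ 0 := by exact_mod_cast Real.pi_ne_zero
  apply mul_left_cancel₀ this
  rw [hk]; ring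

theorem analyticAt_piCot {z : ℂ} (hz : ∀ k : ℤ, z ≠ k) : AnalyticAt ℂ piCot z :=
  AnalyticAt.div (by fun_prop) (by fun_prop) (sin_pi_mul_ne_zero hz)

theorem meromorphicAt_piCot (z : ℂ) : MeromorphicAt piCot z :=
  MeromorphicAt.div (AnalyticAt.meromorphicAt (by fun_prop)) (AnalyticAt.meromorphicAt (by fun_prop))

/-- The pole at 0 is simple with residue 1/π; a removable zero of the sine is divided out by
`dslope`. -/
theorem piCot_eq_div : ∃ k : ℂ → ℂ, AnalyticAt ℂ k 0 ∧ k 0 = (Real.pi : ℂ)⁻¹ ∧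
    ∀ z ≠ 0, piCot z = k z / z := by
  have hs : HasDerivAt (fun z : ℂ => Complex.sin (Real.pi * z)) (Real.pi : ℂ) 0 := by
    simpa using (((hasDerivAt_id (0 : ℂ)).const_mul (Real.pi : ℂ)).csin)
  have han : AnalyticAt ℂ (dslope (fun z : ℂ => Complex.sin (Real.pi * z)) 0) 0 := by
    have h : AnalyticAt ℂ (fun z : ℂ => Complex.sin (Real.pi * z)) 0 := by fun_prop
    exact ⟨_, h.hasFPowerSeriesAt.has_fpower_series_dslope_fslope⟩
  have h0 : dslope (fun z : ℂ => Complex.sin (Real.pi * z)) 0 0 = Real.pi := by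
    rw [dslope_same, hs.deriv]
  have hpi : (Real.pi : ℂ) ≠ 0 := by exact_mod_cast Real.pi_ne_zero
  refine ⟨fun z => Complex.cos (Real.pi * z) /
    dslope (fun z : ℂ => Complex.sin (Real.pi * z)) 0 z,
    AnalyticAt.div (by fun_prop) han (by rw [h0]; exact hpi), by simp only [h0]; simp, fun z hz => ?_⟩
  simp only [dslope_of_ne _ hz, slope_def_field, piCot, mul_zero, Complex.sin_zero, sub_zero]
  rw [div_div, div_mul_cancel₀ _ hz]

theorem analyticAt_Gamma {z : ℂ} (hz : ∀ m : ℕ, z ≠ -m) : AnalyticAt ℂ Complex.Gamma z := by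
  have := (Complex.differentiable_one_div_Gamma.analyticAt z).inv
    (inv_ne_zero (Complex.Gamma_ne_zero hz))
  simpa [Pi.inv_def] using this

theorem meromorphicAt_Gamma (z : ℂ) : MeromorphicAt Complex.Gamma z := by
  have := (Complex.differentiable_one_div_Gamma.analyticAt z).meromorphicAt.inv
  simpa [Pi.inv_def] using this

/-! ### The residue between a contour and its unit translate -/

namespace IsSeparatingContour
variable {C : ℝ → ℂ} {A B : Set ℂ} (hC : IsSeparatingContour C A B)
include hC

theorem ne_of_mem_right {p : ℂ} (hp : p ∈ A) (t : ℝ) : C t ≠ p := fun h => by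
  obtain ⟨r₀, hr⟩ := hC.right p hp
  exact (hr r₀ le_rfl).source_mem ⟨t, h⟩

theorem ne_of_mem_left {p : ℂ} (hp : p ∈ B) (t : ℝ) : C t ≠ p := fun h => by
  obtain ⟨r₀, hr⟩ := hC.left p hp
  exact (hr r₀ le_rfl).source_mem ⟨t, h⟩

/-- The residue formula for the shift of the contour by one over a single simple pole `q`. -/
theorem tendsto_integral_shift_mul_piCot (hAB : Disjoint A B)
    (hAf : ∀ M : ℝ, {z ∈ A | z.re ≤ M}.Finite) (hBf : ∀ M : ℝ, {z ∈ B | -M ≤ z.re}.Finite)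
    {q : ℂ} (hqA : ∀ k : ℕ, q + k ∈ A) (hqB : ∀ k : ℕ, q - 1 - k ∈ B) {G : ℂ → ℂ}
    (hG : ∀ z, ¬(z ∈ A ∧ z - 1 ∈ A) → ¬(z ∈ B ∧ z - 1 ∈ B) → AnalyticAt ℂ G z)
    (hGm : ∀ z, MeromorphicAt G z) (hGd : RapidDecay G) :
    Tendsto (fun Y => ∫ t in -Y..Y, (G (C t + 1) * piCot (C t + 1 - q)
      - G (C t) * piCot (C t - q)) * deriv C t) atTop (𝓝 (2 * Complex.I * G q)) := by
  have hV := hC.isVerticalContour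
  have hq0 : q ∈ A := by simpa using hqA 0
  have hq1 : q - 1 ∈ B := by simpa using hqB 0
  have hqn : ∀ z, ¬(z ∈ A ∧ z - 1 ∈ A) → ¬(z ∈ B ∧ z - 1 ∈ B) → z ≠ q →
      ∀ k : ℤ, z - q ≠ k := by
    intro z h1 h2 hzq k hk
    rcases lt_trichotomy k 0 with h | h | h
    · obtain ⟨m, hm⟩ : ∃ m : ℕ, k = -1 - m := ⟨(-1 - k).toNat, by omega⟩
      refine h2 ⟨?_, ?_⟩
      · convert hqB m using 1; rw [hm] at hk; push_cast at hk; linear_combination hk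
      · convert hqB (m + 1) using 1; rw [hm] at hk; push_cast at hk ⊢; linear_combination hk
    · rw [h] at hk; exact hzq (by simpa [sub_eq_zero] using hk)
    · obtain ⟨m, hm⟩ : ∃ m : ℕ, k = m + 1 := ⟨(k - 1).toNat, by omega⟩
      refine h1 ⟨?_, ?_⟩
      · convert hqA (m + 1) using 1; rw [hm] at hk; push_cast at hk ⊢; linear_combination hk
      · convert hqA m using 1; rw [hm] at hk; push_cast at hk; linear_combination hk
  have hGq : AnalyticAt ℂ G q := hG q (fun h => disjoint_left.mp hAB h.2 hq1)
    (fun h => disjoint_left.mp hAB hq0 h.1)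
  obtain ⟨κ, hκ, hκ0, hcot⟩ := piCot_eq_div
  set h : ℂ → ℂ := fun z => G z * κ (z - q) with hh
  have hha : AnalyticAt ℂ h q := by
    refine hGq.mul (AnalyticAt.comp (g := κ) (f := fun z => z - q) (by simpa using hκ) (by fun_prop))
  have hda : AnalyticAt ℂ (dslope h q) q :=
    ⟨_, hha.hasFPowerSeriesAt.has_fpower_series_dslope_fslope⟩
  have hhq : h q = (Real.pi : ℂ)⁻¹ * G q := by simp [hh, hκ0, mul_comm]
  -- The simple pole at q has been subtracted, so order 0 is enough: this only repairs the value at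
  -- q.
  obtain ⟨_, k, hk, hfk⟩ := exists_eq_add_principalPart (p := q) 0
    (g := fun z => G z * piCot (z - q) - h q * (z - q)⁻¹) hda (by
      filter_upwards [self_mem_nhdsWithin] with z hz
      have hz : z - q ≠ 0 := sub_ne_zero.mpr hz
      rw [hcot _ hz, dslope_of_ne _ (sub_ne_zero.mp hz), slope_def_field, pow_zero, div_one]
      simp only [hh]
      field_simp)
  simp only [Finset.range_zero, Finset.sum_empty, add_zero] at hfk
  have hev : ∀ z ≠ q, k =ᶠ[𝓝 z] fun w => G w * piCot (w - q) - h q * (w - q)⁻¹ := fun z hz => by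
    filter_upwards [isOpen_ne.mem_nhds hz] with w hw
    exact (hfk w hw).symm
  have hinv : ∀ z ≠ q, AnalyticAt ℂ (fun w => h q * (w - q)⁻¹) z := fun z hz =>
    analyticAt_const.mul (AnalyticAt.inv (by fun_prop) (sub_ne_zero.mpr hz))
  have hka : ∀ z, ¬(z ∈ A ∧ z - 1 ∈ A) → ¬(z ∈ B ∧ z - 1 ∈ B) → AnalyticAt ℂ k z := by
    intro z h1 h2
    rcases eq_or_ne z q with rfl | hzq
    · exact hk
    · refine AnalyticAt.congr (((hG z h1 h2).mul ?_).sub (hinv z hzq)) (hev z hzq).symm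
      exact AnalyticAt.comp (g := piCot) (f := fun w => w - q)
        (analyticAt_piCot (hqn z h1 h2 hzq)) (by fun_prop)
  have hkm : ∀ z, MeromorphicAt k z := by
    intro z
    rcases eq_or_ne z q with rfl | hzq
    · exact hk.meromorphicAt
    · refine MeromorphicAt.congr (((hGm z).mul ?_).sub (hinv z hzq).meromorphicAt)
        ((hev z hzq).filter_mono nhdsWithin_le_nhds).symm
      exact (meromorphicAt_piCot (z - q)).comp_analyticAt (f := piCot) (g := fun w => w - q)
        (by fun_prop)
  obtain ⟨M₀, -, hM₀⟩ := hV.exists_abs_re_lt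
  set M := M₀ + 1 with hM
  have hPf : ({z ∈ A | z.re ≤ M} ∪ {z ∈ B | -M ≤ z.re}).Finite := (hAf M).union (hBf M)
  classical
  -- Apart from q, poles can occur only at points p with p and p-1 on the same side of C; these do
  -- not contribute to the shift.
  set P := hPf.toFinset.filter fun z => (z ∈ A ∧ z - 1 ∈ A) ∨ (z ∈ B ∧ z - 1 ∈ B) with hP
  have hPmem : ∀ p ∈ P, (p ∈ A ∧ p - 1 ∈ A) ∨ (p ∈ B ∧ p - 1 ∈ B) := fun p hp =>
    (Finset.mem_filter.mp hp).2
  have hPnot : ∀ z, |z.re| < M → z ∉ P → ¬(z ∈ A ∧ z - 1 ∈ A) ∧ ¬(z ∈ B ∧ z - 1 ∈ B) := by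
    intro z hz hzP
    rw [← not_or]
    intro hor
    refine hzP (Finset.mem_filter.mpr ⟨?_, hor⟩)
    rw [Set.Finite.mem_toFinset]
    have := abs_lt.mp hz
    rcases hor with h | h
    · exact Or.inl ⟨h.1, this.2.le⟩
    · exact Or.inr ⟨h.1, this.1.le⟩
  have hPC : ∀ p ∈ P, ∀ t, C t ≠ p ∧ C t + 1 ≠ p := by
    intro p hp t
    rw [Ne, Ne, ← eq_sub_iff_add_eq]
    rcases hPmem p hp with h | h
    · exact ⟨hC.ne_of_mem_right h.1 t, hC.ne_of_mem_right h.2 t⟩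
    · exact ⟨hC.ne_of_mem_left h.1 t, hC.ne_of_mem_left h.2 t⟩
  have hr : ∀ p ∈ A, _ := fun p hp => hV.tendsto_winding_of_right (hC.right p hp)
  have hl : ∀ p ∈ B, _ := fun p hp => hV.tendsto_winding_of_left (hC.left p hp)
  have main := hV.tendsto_integral_shift (M := M) (fun t => by linarith [hM₀ t]) P (g := k)
    (fun z hz hzP => (hka z (hPnot z hz hzP).1 (hPnot z hz hzP).2).differentiableAt)
    (fun p _ => hkm p) hPC
    (fun p hp => by
      rcases hPmem p hp with h | h
      · simpa using (hr _ h.2).sub (hr _ h.1)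
      · simpa using (hl _ h.2).sub (hl _ h.1))
    (fun ε hε => by
      -- The cotangent is at most 2 in modulus, so ε/4 leaves ε/2 for the subtracted pole.
      obtain ⟨T, hT⟩ := hGd.exists_norm_le M (show 0 < ε / 4 by positivity)
      refine ⟨max T (max (|q.im| + 1) (|q.im| + ‖h q‖ / (ε / 2))), fun z hz hzT => ?_⟩
      have h1 := hT z hz.le ((le_max_left _ _).trans hzT)
      have h2 := ((le_max_left _ _).trans (le_max_right _ _)).trans hzT
      have h3 := ((le_max_right _ _).trans (le_max_right _ _)).trans hzT
      have him : |z.im| - |q.im| ≤ |(z - q).im| := by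
        rw [Complex.sub_im]; exact abs_sub_abs_le_abs_sub _ _
      have hzq : z ≠ q := fun h => by rw [h] at h2; linarith
      have h4 := norm_piCot_le (z := z - q) (by linarith)
      have h5 : ‖h q‖ / (ε / 2) ≤ ‖z - q‖ := by
        linarith [Complex.abs_im_le_norm (z - q)]
      have h6 : 0 < ‖z - q‖ := norm_pos_iff.mpr (sub_ne_zero.mpr hzq)
      have h7 : ‖h q * (z - q)⁻¹‖ ≤ ε / 2 := by
        rw [norm_mul, norm_inv, ← div_eq_mul_inv, div_le_iff₀ h6]
        rwa [div_le_iff₀ (by positivity), mul_comm] at h5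
      have h8 : ‖G z * piCot (z - q)‖ ≤ ε / 4 * 2 := by
        rw [norm_mul]; gcongr
      rw [← hfk z hzq]
      linarith [norm_sub_le (G z * piCot (z - q)) (h q * (z - q)⁻¹)])
  have hw := ((hl _ hq1).sub (hr _ hq0)).const_mul (h q)
  have hlim := main.add hw
  -- Since q is on the right and q-1 on the left, the windings differ by 2πi; the residue is G(q)/π.
  have hval : (0 : ℂ) + h q * (Real.pi * Complex.I - -(Real.pi * Complex.I))
      = 2 * Complex.I * G q := by
    have hpi : (Real.pi : ℂ) ≠ 0 := by exact_mod_cast Real.pi_ne_zero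
    rw [hhq]; field_simp; ring
  rw [hval] at hlim
  refine hlim.congr fun Y => ?_
  have hc1 : Continuous fun t => C t + 1 := hV.continuous.add continuous_const
  have hinv1 : Continuous fun t => (C t - (q - 1))⁻¹ :=
    (hV.continuous.sub continuous_const).inv₀ fun t =>
      sub_ne_zero.mpr (hC.ne_of_mem_left hq1 t)
  have hinv0 : Continuous fun t => (C t - q)⁻¹ :=
    (hV.continuous.sub continuous_const).inv₀ fun t =>
      sub_ne_zero.mpr (hC.ne_of_mem_right hq0 t)
  have hkc : ∀ u : ℝ → ℂ, Continuous u → (∀ t, |(u t).re| < M) → (∀ p ∈ P, ∀ t, u t ≠ p) →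
      Continuous fun t => k (u t) := fun u hu hu' hup => by
    rw [continuous_iff_continuousAt]
    intro t
    have := hPnot (u t) (hu' t) fun h => hup _ h t rfl
    exact ContinuousAt.comp (g := k) (hka _ this.1 this.2).continuousAt hu.continuousAt
  have hk0 := hkc C hV.continuous (fun t => by linarith [hM₀ t]) fun p hp t => (hPC p hp t).1
  have hk1 := hkc _ hc1 (fun t => by
    have := abs_add_le (C t).re 1
    rw [abs_one] at this
    simpa using this.trans_lt (by linarith [hM₀ t])) fun p hp t => (hPC p hp t).2
  have hk2 : Continuous fun t => k (C t + 1) - k (C t) := hk1.sub hk0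
  rw [winding, winding, ← intervalIntegral.integral_sub (hV.intervalIntegrable hinv1 _ _)
    (hV.intervalIntegrable hinv0 _ _), ← intervalIntegral.integral_const_mul,
    ← intervalIntegral.integral_add (hV.intervalIntegrable hk2 _ _)
      (((hV.intervalIntegrable hinv1 _ _).sub (hV.intervalIntegrable hinv0 _ _)).const_mul _)]
  refine intervalIntegral.integral_congr fun t _ => ?_
  have e0 := hfk _ (hC.ne_of_mem_right hq0 t)
  have e1 := hfk (C t + 1) fun h => hC.ne_of_mem_left hq1 t (by rw [← h]; ring)
  simp only [← e0, ← e1, show C t - (q - 1) = C t + 1 - q by ring]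
  ring

end IsSeparatingContour

/-- The reflection formula. In inverted form it also holds at integers, where Gamma takes the value
0 at its poles; the contour may meet such points of the denominators Γ(±(2z+s)). -/
theorem inv_Gamma_mul_Gamma_neg (z : ℂ) :
    (Complex.Gamma (-z) * Complex.Gamma z)⁻¹ = -(z * Complex.sin (Real.pi * z) / Real.pi) := by
  rcases eq_or_ne z 0 with rfl | hz
  · simp
  have h := Complex.Gamma_mul_Gamma_one_sub (-z)
  rw [sub_neg_eq_add, add_comm 1 z, Complex.Gamma_add_one z hz, mul_neg, Complex.sin_neg] at h
  have h2 : Complex.Gamma (-z) * Complex.Gamma z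
      = (-(Real.pi : ℂ) / Complex.sin (Real.pi * z)) / z := by
    rw [eq_div_iff hz, neg_div, ← div_neg, ← h]; ring
  rw [h2, inv_div, div_div_eq_mul_div, div_neg]

/-! ### The continuous weight as an exact difference -/

section Weight
variable {γ δ : ℂ} {N : ℕ}

theorem mem_incPoles {z : ℂ} (k : ℕ)
    (h : z = k ∨ z = 1 - (γ + δ + N + 2) + k ∨ z = -δ + k) : z ∈ incPoles γ δ N := by
  refine ⟨k, ?_⟩
  rcases h with h | h | h
  · exact Or.inl h
  · exact Or.inr (Or.inl (by rw [h]; ring))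
  · exact Or.inr (Or.inr h)

theorem mem_decPoles {z : ℂ} (k : ℕ)
    (h : z = -1 - k ∨ z = -(γ + δ + N + 2) - k ∨ z = -(γ + N + 2) - k) :
    z ∈ decPoles γ δ N := by
  refine ⟨k, ?_⟩
  rcases h with h | h | h
  · exact Or.inr (Or.inl h)
  · exact Or.inl (by rw [h]; ring)
  · exact Or.inr (Or.inr (by rw [h]; ring))

theorem ne_intCast_of_notMem {z : ℂ} (hA : z ∉ incPoles γ δ N) (hB : z ∉ decPoles γ δ N) (k : ℤ) :
    z ≠ k := by
  rintro rfl
  rcases le_or_gt 0 k with h | h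
  · lift k to ℕ using h
    exact hA (mem_incPoles k (Or.inl (by simp)))
  · obtain ⟨m, rfl⟩ : ∃ m : ℕ, k = -1 - m := ⟨(-1 - k).toNat, by omega⟩
    exact hB (mem_decPoles m (Or.inl (by push_cast; ring)))

theorem add_ne_intCast_of_notMem {z : ℂ} (hA : z ∉ incPoles γ δ N) (hB : z ∉ decPoles γ δ N)
    (k : ℤ) : z + (γ + δ + N + 2) ≠ k := by
  intro hk
  rcases le_or_gt 1 k with h | h
  · obtain ⟨m, rfl⟩ : ∃ m : ℕ, k = 1 + m := ⟨(k - 1).toNat, by omega⟩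
    exact hA (mem_incPoles m (Or.inr (Or.inl (by push_cast at hk; linear_combination hk))))
  · obtain ⟨m, rfl⟩ : ∃ m : ℕ, k = -m := ⟨(-k).toNat, by omega⟩
    exact hB (mem_decPoles m (Or.inr (Or.inl (by push_cast at hk; linear_combination hk))))

/-- Reflection pairs Γ(-z)Γ(1+z) and Γ(z+s)Γ(1-s-z) into reciprocal sines. The denominators
contribute (2z+s) sin π(2z+s), and the addition formula splits the quotient into two cotangents. -/
theorem contWeight_eq {z : ℂ} (hA : z ∉ incPoles γ δ N) (hB : z ∉ decPoles γ δ N) :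
    contWeight γ δ N z = Real.pi * (2 * z + (γ + δ + N + 2)) *
      (piCot z + piCot (z + (γ + δ + N + 2))) *
      (Complex.Gamma (γ + N + 2 + z) * Complex.Gamma (-δ - z)) := by
  set s := γ + δ + N + 2 with hs
  have hI : Complex.I * Complex.I = -1 := Complex.I_mul_I
  have s1 := sin_pi_mul_ne_zero (ne_intCast_of_notMem hA hB)
  have s2 := sin_pi_mul_ne_zero (add_ne_intCast_of_notMem hA hB)
  rw [← hs] at s2
  have hpi : (Real.pi : ℂ) ≠ 0 := by exact_mod_cast Real.pi_ne_zero
  have g1 : Complex.Gamma (-z) * Complex.Gamma (1 + z)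
      = -(Real.pi / Complex.sin (Real.pi * z)) := by
    have := Complex.Gamma_mul_Gamma_one_sub (-z)
    rw [sub_neg_eq_add, mul_neg, Complex.sin_neg, div_neg] at this
    exact this
  have g2 : Complex.Gamma (z + s) * Complex.Gamma (1 - s - z)
      = Real.pi / Complex.sin (Real.pi * (z + s)) := by
    rw [← Complex.Gamma_mul_Gamma_one_sub]; congr 2; ring
  have g3 := inv_Gamma_mul_Gamma_neg (2 * z + s)
  have hsin : Complex.sin (Real.pi * (2 * z + s)) =
      Complex.sin (Real.pi * z) * Complex.cos (Real.pi * (z + s))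
      + Complex.cos (Real.pi * z) * Complex.sin (Real.pi * (z + s)) := by
    rw [← Complex.sin_add]; congr 1; ring
  have e : contWeight γ δ N z = (Complex.Gamma (-z) * Complex.Gamma (1 + z)) *
      (Complex.Gamma (z + s) * Complex.Gamma (1 - s - z)) *
      (Complex.Gamma (γ + N + 2 + z) * Complex.Gamma (-δ - z)) *
      (Complex.Gamma (-(2 * z + s)) * Complex.Gamma (2 * z + s))⁻¹ := by
    rw [contWeight, nu, nu]
    have a1 : ∀ w : ℂ, w + Complex.I * (Complex.I * (z + 1 + (γ + δ + N) / 2)) =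
        w - (z + 1 + (γ + δ + N) / 2) := fun w => by
      linear_combination (z + 1 + (γ + δ + N) / 2) * hI
    have a2 : ∀ w : ℂ, w + Complex.I * -(Complex.I * (z + 1 + (γ + δ + N) / 2)) =
        w + (z + 1 + (γ + δ + N) / 2) := fun w => by
      linear_combination -(z + 1 + (γ + δ + N) / 2) * hI
    have a3 : 2 * (Complex.I * (z + 1 + (γ + δ + N) / 2)) * Complex.I = -(2 * z + s) := by
      linear_combination (2 * z + s) * hI
    have a4 : 2 * -(Complex.I * (z + 1 + (γ + δ + N) / 2)) * Complex.I = 2 * z + s := by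
      linear_combination -(2 * z + s) * hI
    simp only [a1, a2, a3, a4]
    rw [show 1 + (γ + δ + N) / 2 - (z + 1 + (γ + δ + N) / 2) = -z by ring,
      show 1 + (γ - δ + N) / 2 - (z + 1 + (γ + δ + N) / 2) = -δ - z by ring,
      show -(γ + δ + N) / 2 - (z + 1 + (γ + δ + N) / 2) = 1 - s - z by rw [hs]; ring,
      show 1 + (γ + δ + N) / 2 + (z + 1 + (γ + δ + N) / 2) = z + s by rw [hs]; ring,
      show 1 + (γ - δ + N) / 2 + (z + 1 + (γ + δ + N) / 2) = γ + N + 2 + z by ring,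
      show -(γ + δ + N) / 2 + (z + 1 + (γ + δ + N) / 2) = 1 + z by ring, mul_inv]
    ring
  rw [e, g1, g2, g3, hsin, piCot, piCot]
  field_simp
  ring

theorem incPoles_finite (M : ℝ) : {z ∈ incPoles γ δ N | z.re ≤ M}.Finite := by
  have key : ∀ c : ℂ, {z : ℂ | ∃ k : ℕ, z = c + k ∧ z.re ≤ M}.Finite := fun c => by
    obtain ⟨n, hn⟩ := exists_nat_gt (M - c.re)
    refine ((Set.finite_lt_nat n).image fun k : ℕ => c + k).subset ?_
    rintro _ ⟨k, rfl, hk⟩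
    refine ⟨k, ?_, rfl⟩
    simp only [Complex.add_re, Complex.natCast_re] at hk
    exact_mod_cast (by linarith : (k : ℝ) < n)
  refine (((key 0).union (key (-γ - δ - N - 1))).union (key (-δ))).subset ?_
  rintro z ⟨⟨k, h | h | h⟩, hz⟩
  · exact Or.inl (Or.inl ⟨k, by simpa using h, hz⟩)
  · exact Or.inl (Or.inr ⟨k, h, hz⟩)
  · exact Or.inr ⟨k, h, hz⟩

theorem decPoles_finite (M : ℝ) : {z ∈ decPoles γ δ N | -M ≤ z.re}.Finite := by
  have key : ∀ c : ℂ, {z : ℂ | ∃ k : ℕ, z = c - k ∧ -M ≤ z.re}.Finite := fun c => by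
    obtain ⟨n, hn⟩ := exists_nat_gt (M + c.re)
    refine ((Set.finite_lt_nat n).image fun k : ℕ => c - k).subset ?_
    rintro _ ⟨k, rfl, hk⟩
    refine ⟨k, ?_, rfl⟩
    simp only [Complex.sub_re, Complex.natCast_re] at hk
    exact_mod_cast (by linarith : (k : ℝ) < n)
  refine (((key (-γ - δ - N - 2)).union (key (-1))).union (key (-γ - N - 2))).subset ?_
  rintro z ⟨⟨k, h | h | h⟩, hz⟩
  · exact Or.inl (Or.inl ⟨k, h, hz⟩)
  · exact Or.inl (Or.inr ⟨k, h, hz⟩)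
  · exact Or.inr ⟨k, h, hz⟩

theorem incPoles_countable : (incPoles γ δ N).Countable := by
  have : incPoles γ δ N = ⋃ k : ℕ, {(k : ℂ), -γ - δ - N - 1 + k, -δ + k} := by
    ext z; simp [incPoles]
  rw [this]
  exact countable_iUnion fun k => (Set.toFinite _).countable

theorem decPoles_countable : (decPoles γ δ N).Countable := by
  have : decPoles γ δ N = ⋃ k : ℕ, {-γ - δ - N - 2 - (k : ℂ), -1 - (k : ℂ), -γ - N - 2 - (k : ℂ)} := by
    ext z; simp [decPoles]
  rw [this]
  exact countable_iUnion fun k => (Set.toFinite _).countable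

/-- The Gamma factor of the primitive difference. -/
def gammaPair (γ δ : ℂ) (N l : ℕ) (z : ℂ) : ℂ :=
  Complex.Gamma (γ + N + 2 + l + z) * Complex.Gamma (1 + l - δ - z)

theorem rapidDecay_gammaPair (l : ℕ) : RapidDecay (gammaPair γ δ N l) :=
  (rapidDecay_Gamma_add _).mul (rapidDecay_Gamma_sub _)

theorem meromorphicAt_gammaPair (l : ℕ) (z : ℂ) : MeromorphicAt (gammaPair γ δ N l) z := by
  refine MeromorphicAt.mul ?_ ?_
  · exact (meromorphicAt_Gamma _).comp_analyticAt (f := Complex.Gamma)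
      (g := fun z => γ + N + 2 + l + z) (by fun_prop)
  · exact (meromorphicAt_Gamma _).comp_analyticAt (f := Complex.Gamma)
      (g := fun z => 1 + l - δ - z) (by fun_prop)

theorem analyticAt_gammaPair (l : ℕ) {z : ℂ}
    (hA : ¬(z ∈ incPoles γ δ N ∧ z - 1 ∈ incPoles γ δ N))
    (hB : ¬(z ∈ decPoles γ δ N ∧ z - 1 ∈ decPoles γ δ N)) :
    AnalyticAt ℂ (gammaPair γ δ N l) z := by
  refine AnalyticAt.mul ?_ ?_
  · refine AnalyticAt.comp (g := Complex.Gamma) (f := fun z => γ + N + 2 + l + z)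
      (analyticAt_Gamma fun m hm => hB ⟨?_, ?_⟩) (by fun_prop)
    · exact mem_decPoles (l + m) (Or.inr (Or.inr (by push_cast; linear_combination hm)))
    · exact mem_decPoles (l + m + 1) (Or.inr (Or.inr (by push_cast; linear_combination hm)))
  · refine AnalyticAt.comp (g := Complex.Gamma) (f := fun z => 1 + l - δ - z)
      (analyticAt_Gamma fun m hm => hA ⟨?_, ?_⟩) (by fun_prop)
    · exact mem_incPoles (l + m + 1) (Or.inr (Or.inr (by push_cast; linear_combination -hm)))
    · exact mem_incPoles (l + m) (Or.inr (Or.inr (by push_cast; linear_combination -hm)))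

/-- The product shifts both Gamma factors by l. The difference of `gammaPair` at z+1 and z equals
the shifted Gamma product times (γ+N+2+z+l) - (-δ-z+l) = 2z+s, and the cotangents have period 1. -/
theorem latProd_mul_contWeight {z : ℂ} (hA : z ∉ incPoles γ δ N) (hB : z ∉ decPoles γ δ N)
    (l : ℕ) :
    (latProd (γ + δ + N + 2) (γ + N + 2) l).eval (z * (z + (γ + δ + N + 2))) * contWeight γ δ N z =
      Real.pi * ((gammaPair γ δ N l (z + 1) * piCot (z + 1) - gammaPair γ δ N l z * piCot z)
        + (gammaPair γ δ N l (z + 1) * piCot (z + 1 - (1 - (γ + δ + N + 2)))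
          - gammaPair γ δ N l z * piCot (z - (1 - (γ + δ + N + 2))))) := by
  have n1 : ∀ j : ℕ, γ + N + 2 + z + j ≠ 0 := fun j hj =>
    hB (mem_decPoles j (Or.inr (Or.inr (by linear_combination hj))))
  have n2 : ∀ j : ℕ, -δ - z + j ≠ 0 := fun j hj =>
    hA (mem_incPoles j (Or.inr (Or.inr (by linear_combination -hj))))
  have g1 := Gamma_add_natCast (n := l) fun j _ => n1 j
  have g2 := Gamma_add_natCast (n := l) fun j _ => n2 j
  have g3 := Complex.Gamma_add_one _ (n1 l)
  have g4 := Complex.Gamma_add_one _ (n2 l)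
  rw [latProd_eval, contWeight_eq hA hB, piCot_add_one,
    show z + 1 - (1 - (γ + δ + N + 2)) = z + (γ + δ + N + 2) by ring,
    show z - (1 - (γ + δ + N + 2)) = z + (γ + δ + N + 1) by ring,
    show piCot (z + (γ + δ + N + 1)) = piCot (z + (γ + δ + N + 2)) by
      rw [← piCot_add_one]; congr 1; ring,
    gammaPair, gammaPair,
    show γ + N + 2 + l + (z + 1) = γ + N + 2 + z + l + 1 by ring,
    show 1 + l - δ - (z + 1) = -δ - z + l by ring,
    show γ + N + 2 + l + z = γ + N + 2 + z + l by ring,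
    show 1 + l - δ - z = -δ - z + l + 1 by ring, g3, g4, g1, g2,
    show z + (γ + N + 2) = γ + N + 2 + z by ring,
    show γ + N + 2 - (γ + δ + N + 2) - z = -δ - z by ring]
  ring

end Weight

/-! ### Integrability and moments of the continuous part -/

/-- A parameter where C equals e with nonzero derivative is isolated among such parameters, so they
are countable. This lets the contour cross, or rest at, the exceptional points of the divided
differences. -/
theorem ae_deriv_eq_zero_of_mem (C : ℝ → ℂ) (E : Finset ℂ) : ∀ᵐ t : ℝ, C t ∈ E → deriv C t = 0 := by
  have hcount : ∀ e : ℂ, {t | C t = e ∧ deriv C t ≠ 0}.Countable := by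
    intro e
    have : DiscreteTopology {t | C t = e ∧ deriv C t ≠ 0} := by
      rw [discreteTopology_subtype_iff]
      rintro t ⟨ht, hd⟩
      rw [← disjoint_iff]
      have hev : ∀ᶠ y in 𝓝[≠] t, C y ≠ C t :=
        (differentiableAt_of_deriv_ne_zero hd).hasDerivAt.eventually_ne hd
      rw [Filter.disjoint_principal_right]
      filter_upwards [hev] with y hy hy'
      exact hy (hy'.1.trans ht.symm)
    exact Set.countable_coe_iff.mp (TopologicalSpace.separableSpace_iff_countable.mp inferInstance)
  have hsub : {t : ℝ | ¬(C t ∈ E → deriv C t = 0)} ⊆ ⋃ e ∈ E, {t | C t = e ∧ deriv C t ≠ 0} := by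
    intro t ht
    have ht : ¬(C t ∈ E → deriv C t = 0) := ht
    rw [Classical.not_imp] at ht
    exact mem_iUnion₂.mpr ⟨C t, ht.1, rfl, ht.2⟩
  rw [ae_iff]
  exact ((E.countable_toSet.biUnion fun e _ => hcount e).mono hsub).measure_zero volume

namespace IsVerticalContour
variable {C : ℝ → ℂ} (hC : IsVerticalContour C)
include hC

theorem integrable_of_rapidDecay {f : ℂ → ℂ} (hf : RapidDecay f)
    (hc : Continuous fun t => f (C t)) : Integrable fun t => f (C t) * deriv C t := by
  obtain ⟨L, hL⟩ := hC.bounded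
  obtain ⟨σ, T, hT⟩ := hC.vertical
  -- Quadratic decay suffices to dominate by a multiple of 1/(1+t²).
  obtain ⟨K, T', hK⟩ := hf |σ| 2
  set S := max (max |T| |T'|) 1 with hS
  obtain ⟨K', hK'⟩ := (isCompact_Icc (a := -S) (b := S)).exists_bound_of_continuousOn
    hc.continuousOn
  have hbound : ∀ t, ‖f (C t)‖ ≤ (|K'| * (1 + S ^ 2) + 2 * |K|) * (1 + t ^ 2)⁻¹ := by
    intro t
    rw [← div_eq_mul_inv, le_div_iff₀ (by positivity)]
    rcases le_or_gt |t| S with h | h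
    · have h1 := (hK' t (abs_le.mp h)).trans (le_abs_self K')
      have h2 : t ^ 2 ≤ S ^ 2 := by rw [← sq_abs]; gcongr
      calc ‖f (C t)‖ * (1 + t ^ 2) ≤ |K'| * (1 + S ^ 2) := by gcongr
        _ ≤ _ := by linarith [abs_nonneg K]
    · have hTt : T ≤ |t| := (le_abs_self T).trans (((le_max_left _ _).trans (le_max_left _ _)).trans h.le)
      have hT't : T' ≤ |t| :=
        (le_abs_self T').trans (((le_max_right _ _).trans (le_max_left _ _)).trans h.le)
      have h1t : 1 ≤ |t| := (le_max_right _ _).trans h.le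
      have h1 := hK (C t) (by rw [hT t hTt]; simp) (by rw [hT t hTt]; simpa using hT't)
      have him : (C t).im = t := by rw [hT t hTt]; simp
      rw [him, sq_abs] at h1
      have h2 : 1 ≤ t ^ 2 := by rw [← sq_abs]; nlinarith
      have h3 : ‖f (C t)‖ ≤ ‖f (C t)‖ * t ^ 2 := le_mul_of_one_le_right (norm_nonneg _) h2
      have h4 : 0 ≤ |K'| * (1 + S ^ 2) := by positivity
      linarith [le_abs_self K]
  refine Integrable.mono' (g := fun t => (|K'| * (1 + S ^ 2) + 2 * |K|) * (1 + t ^ 2)⁻¹ * L)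
    ((integrable_inv_one_add_sq.const_mul _).mul_const L)
    (hc.aestronglyMeasurable.mul (measurable_deriv C).aestronglyMeasurable)
    (Eventually.of_forall fun t => ?_)
  rw [norm_mul]
  exact mul_le_mul (hbound t) (hL t) (norm_nonneg _) ((norm_nonneg _).trans (hbound t))

end IsVerticalContour

section Continuous
variable {γ δ : ℂ} {N : ℕ} {C : ℝ → ℂ}
  (hC : IsSeparatingContour C (incPoles γ δ N) (decPoles γ δ N))
include hC

theorem contour_notMem_incPoles (t : ℝ) : C t ∉ incPoles γ δ N :=
  fun h => hC.ne_of_mem_right h t rfl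

theorem contour_notMem_decPoles (t : ℝ) : C t ∉ decPoles γ δ N :=
  fun h => hC.ne_of_mem_left h t rfl

theorem integrable_eval_mul_contWeight (p : Polynomial ℂ) :
    Integrable fun t => p.eval (C t * (C t + (γ + δ + N + 2))) * contWeight γ δ N (C t)
      * deriv C t := by
  have hV := hC.isVerticalContour
  have hA := contour_notMem_incPoles hC
  have hB := contour_notMem_decPoles hC
  set s := γ + δ + N + 2 with hs
  set f : ℂ → ℂ := fun z => (Complex.Gamma (γ + N + 2 + z) * Complex.Gamma (-δ - z)
    * (piCot z + piCot (z + s))) * (Polynomial.C (Real.pi : ℂ) * (2 * Polynomial.X + Polynomial.C s)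
      * p.comp (Polynomial.X * (Polynomial.X + Polynomial.C s))).eval z with hf
  have hdecay : RapidDecay f := by
    refine RapidDecay.mul_eval (((rapidDecay_Gamma_add _).mul
      (rapidDecay_Gamma_sub _)).mul_bounded fun R => ⟨4, |s.im| + 1, fun z _ hz => ?_⟩) _
    have h1 := norm_piCot_le (z := z) (by linarith [abs_nonneg s.im])
    have h2 := norm_piCot_le (z := z + s) (by
      have := abs_sub_abs_le_abs_sub z.im (-s.im)
      rw [abs_neg, sub_neg_eq_add] at this
      rw [Complex.add_im]; linarith)
    linarith [norm_add_le (piCot z) (piCot (z + s))]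
  have hcont : Continuous fun t => f (C t) := by
    rw [continuous_iff_continuousAt]
    intro t
    refine ContinuousAt.comp (g := f) ?_ hV.continuous.continuousAt
    refine ContinuousAt.mul (AnalyticAt.continuousAt (𝕜 := ℂ) (((AnalyticAt.mul ?_ ?_)).mul
      (AnalyticAt.add ?_ ?_))) (Polynomial.continuousAt _)
    · refine AnalyticAt.comp (g := Complex.Gamma) (f := fun z => γ + N + 2 + z)
        (analyticAt_Gamma fun m hm => hB t ?_) (by fun_prop)
      exact mem_decPoles m (Or.inr (Or.inr (by linear_combination hm)))
    · refine AnalyticAt.comp (g := Complex.Gamma) (f := fun z => -δ - z)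
        (analyticAt_Gamma fun m hm => hA t ?_) (by fun_prop)
      exact mem_incPoles m (Or.inr (Or.inr (by linear_combination -hm)))
    · exact analyticAt_piCot (ne_intCast_of_notMem (hA t) (hB t))
    · exact AnalyticAt.comp (g := piCot) (f := fun z => z + s)
        (analyticAt_piCot (add_ne_intCast_of_notMem (hA t) (hB t))) (by fun_prop)
  refine (hV.integrable_of_rapidDecay hdecay hcont).congr (Eventually.of_forall fun t => ?_)
  simp only [hf, contWeight_eq (hA t) (hB t), Polynomial.eval_mul, Polynomial.eval_add,
    Polynomial.eval_comp, Polynomial.eval_X, Polynomial.eval_C, Polynomial.eval_ofNat]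
  ring

/-- The continuous part of the bilinear form, as a functional. -/
theorem exists_contFunctional : ∃ L : Polynomial ℂ →ₗ[ℂ] ℂ, ∀ p, L p =
    ∫ t, p.eval (C t * (C t + (γ + δ + N + 2))) * contWeight γ δ N (C t) * deriv C t := by
  refine ⟨⟨⟨fun p => ∫ t, p.eval (C t * (C t + (γ + δ + N + 2))) * contWeight γ δ N (C t)
    * deriv C t, fun p q => ?_⟩, fun a p => ?_⟩, fun p => rfl⟩
  · rw [← integral_add (integrable_eval_mul_contWeight hC p) (integrable_eval_mul_contWeight hC q)]
    simp only [Polynomial.eval_add, add_mul]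
  · simp only [RingHom.id_apply, smul_eq_mul]
    rw [← integral_const_mul]
    simp only [Polynomial.eval_smul, smul_eq_mul, mul_assoc]

/-- The residue formula is applied at q = 0 and q = 1-s, each the first term of an increasing
sequence with q-1 starting a decreasing one. The two values of `gammaPair` agree, since z ↦ 1-s-z
exchanges its factors. -/
theorem integral_latProd_mul_contWeight (hAB : Disjoint (incPoles γ δ N) (decPoles γ δ N)) (l : ℕ) :
    ∫ t, (latProd (γ + δ + N + 2) (γ + N + 2) l).eval (C t * (C t + (γ + δ + N + 2)))
        * contWeight γ δ N (C t) * deriv C t =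
      4 * Real.pi * Complex.I * (Complex.Gamma (γ + N + 2 + l) * Complex.Gamma (1 - δ + l)) := by
  have hV := hC.isVerticalContour
  have hA := contour_notMem_incPoles hC
  have hB := contour_notMem_decPoles hC
  have hint := integrable_eval_mul_contWeight hC (latProd (γ + δ + N + 2) (γ + N + 2) l)
  have h1 := intervalIntegral_tendsto_integral hint tendsto_neg_atTop_atBot tendsto_id
  refine tendsto_nhds_unique h1 ?_
  set s := γ + δ + N + 2 with hs
  have shift : ∀ q : ℂ, _ := fun q hqA hqB => hC.tendsto_integral_shift_mul_piCot hAB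
    incPoles_finite decPoles_finite (q := q) hqA hqB (G := gammaPair γ δ N l)
    (fun z => analyticAt_gammaPair l) (meromorphicAt_gammaPair l) (rapidDecay_gammaPair l)
  have e0 := shift 0 (fun k => mem_incPoles k (Or.inl (by simp)))
    (fun k => mem_decPoles k (Or.inl (by ring)))
  have e1 := shift (1 - s) (fun k => mem_incPoles k (Or.inr (Or.inl (by rw [hs]))))
    (fun k => mem_decPoles k (Or.inr (Or.inl (by rw [hs]; ring))))
  simp only [sub_zero] at e0
  have hsum := (e0.add e1).const_mul (Real.pi : ℂ)
  have hval : (Real.pi : ℂ) * (2 * Complex.I * gammaPair γ δ N l 0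
      + 2 * Complex.I * gammaPair γ δ N l (1 - s)) =
      4 * Real.pi * Complex.I * (Complex.Gamma (γ + N + 2 + l) * Complex.Gamma (1 - δ + l)) := by
    rw [gammaPair, gammaPair, hs,
      show γ + N + 2 + l + (1 - (γ + δ + N + 2)) = 1 - δ + l by ring,
      show 1 + l - δ - (1 - (γ + δ + N + 2)) = γ + N + 2 + l by ring, add_zero, sub_zero,
      show 1 + l - δ = 1 - δ + l by ring]
    ring
  rw [hval] at hsum
  refine hsum.congr fun Y => ?_
  have hcont : ∀ u : ℝ → ℂ, Continuous u →
      (∀ t, ¬(u t ∈ incPoles γ δ N ∧ u t - 1 ∈ incPoles γ δ N)) →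
      (∀ t, ¬(u t ∈ decPoles γ δ N ∧ u t - 1 ∈ decPoles γ δ N)) →
      Continuous fun t => gammaPair γ δ N l (u t) := fun u hu h1 h2 => by
    rw [continuous_iff_continuousAt]
    exact fun t => ContinuousAt.comp (g := gammaPair γ δ N l)
      (analyticAt_gammaPair l (h1 t) (h2 t)).continuousAt hu.continuousAt
  have hcot : ∀ u : ℝ → ℂ, Continuous u → (∀ t, ∀ k : ℤ, u t ≠ k) →
      Continuous fun t => piCot (u t) := fun u hu h => by
    rw [continuous_iff_continuousAt]
    exact fun t => ContinuousAt.comp (g := piCot) (analyticAt_piCot (h t)).continuousAt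
      hu.continuousAt
  have hc1 : Continuous fun t => C t + 1 := hV.continuous.add continuous_const
  have hz := fun t => ne_intCast_of_notMem (hA t) (hB t)
  have hzs := fun t => add_ne_intCast_of_notMem (hA t) (hB t)
  rw [← hs] at hzs
  have g0 := hcont C hV.continuous (fun t h => hA t h.1) (fun t h => hB t h.1)
  have g1 := hcont _ hc1 (fun t h => hA t (by simpa using h.2))
    (fun t h => hB t (by simpa using h.2))
  have i0 : Continuous fun t => gammaPair γ δ N l (C t + 1) * piCot (C t + 1)
      - gammaPair γ δ N l (C t) * piCot (C t) :=
    (g1.mul (hcot _ hc1 fun t k h => hz t (k - 1) (by push_cast; rw [← h]; ring))).sub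
      (g0.mul (hcot _ hV.continuous hz))
  have i1 : Continuous fun t => gammaPair γ δ N l (C t + 1) * piCot (C t + 1 - (1 - s))
      - gammaPair γ δ N l (C t) * piCot (C t - (1 - s)) :=
    (g1.mul (hcot _ (hc1.sub continuous_const) fun t k h =>
      hzs t k (by have h : C t + 1 - (1 - s) = k := h; rw [← h]; ring))).sub
      (g0.mul (hcot _ (hV.continuous.sub continuous_const) fun t k h =>
      hzs t (k + 1) (by have h : C t - (1 - s) = k := h; push_cast; rw [← h]; ring)))
  rw [← intervalIntegral.integral_add (hV.intervalIntegrable i0 _ _)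
    (hV.intervalIntegrable i1 _ _), ← intervalIntegral.integral_const_mul]
  refine intervalIntegral.integral_congr fun t _ => ?_
  rw [hs, latProd_mul_contWeight (hA t) (hB t)]
  ring

end Continuous

theorem contIntegrand_ae_eq {γ δ : ℂ} {N : ℕ} {C : ℝ → ℂ} {p q r r' : Polynomial ℂ} (hp : HasLatDiff γ δ (N + 1) p r)
    (hq : HasLatDiff γ δ (N + 1) q r') :
    contIntegrand γ δ N C p q =ᵐ[volume] fun t =>
      (r * r').eval (C t * (C t + (γ + δ + N + 2))) * contWeight γ δ N (C t) * deriv C t := by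
  obtain ⟨E, hE⟩ := hp
  obtain ⟨E', hE'⟩ := hq
  filter_upwards [ae_deriv_eq_zero_of_mem C E,
    ae_deriv_eq_zero_of_mem C E'] with t h h'
  rw [contIntegrand]
  by_cases hd : deriv C t = 0
  · rw [hd]; simp
  rw [hE _ fun hm => hd (h hm), hE' _ fun hm => hd (h' hm), Polynomial.eval_mul,
    show γ + δ + 1 + ((N + 1 : ℕ) : ℂ) = γ + δ + N + 2 by push_cast; ring]

end Analytic

end DualHahn

end

/-! ### The two parts of the Sobolev form combined -/

theorem mainTheorem6 (γ δ : ℂ) (N : ℕ) :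
    (∀ n : ℕ, N < n → ∀ x : ℂ,
      (DualHahn.dualHahn γ δ N n).eval (DualHahn.lat γ δ x) =
        (DualHahn.dualHahn γ δ N (N + 1)).eval (DualHahn.lat γ δ x) * (-1) ^ (n - N - 1) *
          (DualHahn.contDualHahn (N + (γ + δ + 3) / 2) ((-γ - δ + 1) / 2) ((γ - δ + 1) / 2)
            (n - N - 1)).eval ((Complex.I * x + Complex.I * ((γ + δ + 1) / 2)) ^ 2)) ∧
    (Disjoint (DualHahn.incPoles γ δ N) (DualHahn.decPoles γ δ N) →
      (∀ x : ℕ, x ≤ N →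
        DualHahn.poch (x + γ + δ + 1) (N + 1) ≠ 0 ∧ DualHahn.poch (δ + 1) x ≠ 0) →
      (∃ C : ℝ → ℂ, DualHahn.IsSeparatingContour C
        (DualHahn.incPoles γ δ N) (DualHahn.decPoles γ δ N)) ∧
      ∀ C : ℝ → ℂ, DualHahn.IsSeparatingContour C
          (DualHahn.incPoles γ δ N) (DualHahn.decPoles γ δ N) →
        (∀ p q : Polynomial ℂ,
          MeasureTheory.Integrable (DualHahn.contIntegrand γ δ N C p q)) ∧
        (∀ m n : ℕ, m ≠ n →
          DualHahn.sobolevForm γ δ N C (DualHahn.dualHahn γ δ N m)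
            (DualHahn.dualHahn γ δ N n) = 0) ∧
        ((∀ j : ℕ, 1 ≤ j → j ≤ N → γ ≠ -(j : ℂ)) →
          ∀ n : ℕ, DualHahn.sobolevForm γ δ N C (DualHahn.dualHahn γ δ N n)
            (DualHahn.dualHahn γ δ N n) ≠ 0)) := by
  open DualHahn in
  refine ⟨fun n hn x => dualHahn_factorization γ δ N n hn x, fun hAB hw => ⟨?_, fun C hC => ?_⟩⟩
  · exact exists_isSeparatingContour incPoles_countable decPoles_countable hAB
      incPoles_finite decPoles_finite
  have hsum : ∀ p q, ∑ x ∈ Finset.range (N + 1), p.eval (lat γ δ x) * q.eval (lat γ δ x)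
      * discreteWeight γ δ N x = discreteFunctional γ δ N (p * q) := fun p q => by
    simp only [discreteFunctional_apply, Polynomial.eval_mul]
  have hsum0 : ∀ m n, N < m ∨ N < n →
      discreteFunctional γ δ N (dualHahn γ δ N m * dualHahn γ δ N n) = 0 := fun m n h => by
    rw [discreteFunctional_apply]
    refine Finset.sum_eq_zero fun x hx => ?_
    have hx : x ≤ N := Nat.lt_succ_iff.mp (Finset.mem_range.mp hx)
    rw [Polynomial.eval_mul]
    rcases h with h | h <;> rw [dualHahn_eval_lat_natCast_eq_zero γ δ h hx] <;> simp
  obtain ⟨L, hL⟩ := exists_contFunctional hC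
  have hint : ∀ p q r r', HasLatDiff γ δ (N + 1) p r → HasLatDiff γ δ (N + 1) q r' →
      ∫ t, contIntegrand γ δ N C p q t = L (r * r') := fun p q r r' hp hq => by
    rw [hL]; exact integral_congr_ae (contIntegrand_ae_eq hp hq)
  have hint0 : ∀ m n, m ≤ N ∨ n ≤ N →
      ∫ t, contIntegrand γ δ N C (dualHahn γ δ N m) (dualHahn γ δ N n) t = 0 := fun m n h => by
    obtain ⟨r, hr⟩ := exists_hasLatDiff γ δ (N + 1) (dualHahn γ δ N m)
    obtain ⟨r', hr'⟩ := exists_hasLatDiff γ δ (N + 1) (dualHahn γ δ N n)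
    rcases h with h | h
    · rw [hint _ _ _ _ (hasLatDiff_dualHahn_of_le γ δ h) hr', zero_mul, map_zero]
    · rw [hint _ _ _ _ hr (hasLatDiff_dualHahn_of_le γ δ h), mul_zero, map_zero]
  -- If γ+N+2 = -j, the sequences starting at 0 and -γ-N-2 would meet; if 1-δ = -j, those starting
  -- at -δ and -1 would. Hence both Gamma values in the norm are finite and nonzero.
  have hu : ∀ j : ℕ, γ + N + 2 ≠ -j := fun j hj =>
    Set.disjoint_left.mp hAB (mem_incPoles (z := j) j (Or.inl rfl))
      (mem_decPoles 0 (Or.inr (Or.inr (by push_cast; linear_combination hj))))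
  have hv : ∀ j : ℕ, 1 - δ ≠ -j := fun j hj =>
    Set.disjoint_left.mp hAB (mem_incPoles (z := -δ) 0 (Or.inr (Or.inr (by simp))))
      (mem_decPoles j (Or.inl (by linear_combination hj)))
  have hmom := functional_moments_of_latProd (L := L) (s := γ + δ + N + 2) (u := γ + N + 2) (v := 1)
    (K := 4 * Real.pi * Complex.I * (Complex.Gamma (γ + N + 2) * Complex.Gamma (1 - δ)))
    fun l => by
      rw [hL, integral_latProd_mul_contWeight hC hAB,
        Gamma_add_natCast fun j _ h => hu j (eq_neg_of_add_eq_zero_left h),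
        Gamma_add_natCast fun j _ h => hv j (eq_neg_of_add_eq_zero_left h),
        show 1 - (γ + δ + N + 2) + (γ + N + 2) = 1 - δ by ring]
      ring
  rw [show 1 - (γ + δ + N + 2) + (γ + N + 2) = 1 - δ by ring] at hmom
  have hdisc := discreteFunctional_moments γ δ N hw
  refine ⟨fun p q => ?_, fun m n hmn => ?_, fun hγ n => ?_⟩
  · obtain ⟨r, hr⟩ := exists_hasLatDiff γ δ (N + 1) p
    obtain ⟨r', hr'⟩ := exists_hasLatDiff γ δ (N + 1) q
    exact (integrable_eval_mul_contWeight hC (r * r')).congr (contIntegrand_ae_eq hr hr').symm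
  · rw [sobolevForm, hsum]
    by_cases h : m ≤ N ∧ n ≤ N
    · rw [hint0 m n (Or.inl h.1), dualHahn_eq_hahnFamily, dualHahn_eq_hahnFamily,
        functional_hahnFamily_orthogonal hdisc hmn, add_zero]
    rw [hsum0 m n (by omega), zero_add]
    by_cases h' : m ≤ N ∨ n ≤ N
    · exact hint0 m n h'
    obtain ⟨i, rfl⟩ : ∃ i, m = N + 1 + i := ⟨m - N - 1, by omega⟩
    obtain ⟨j, rfl⟩ : ∃ j, n = N + 1 + j := ⟨n - N - 1, by omega⟩
    rw [hint _ _ _ _ (hasLatDiff_dualHahn_of_lt γ δ N i) (hasLatDiff_dualHahn_of_lt γ δ N j),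
      smul_mul_smul_comm, map_smul, functional_hahnFamily_orthogonal hmom (by omega), smul_zero]
  · rw [sobolevForm, hsum]
    have hfac : ∀ k : ℕ, (k.factorial : ℂ) ≠ 0 := fun k => by exact_mod_cast k.factorial_ne_zero
    by_cases h : n ≤ N
    · obtain ⟨-, hδ⟩ := hw N le_rfl
      rw [hint0 n n (Or.inl h), add_zero, dualHahn_eq_hahnFamily, functional_hahnFamily_sq hdisc]
      refine mul_ne_zero (mul_ne_zero (mul_ne_zero (mul_ne_zero (inv_ne_zero hδ) ?_) ?_) ?_) (hfac n)
      · refine poch_ne_zero.mpr fun j hj h0 => ?_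
        have : ((N - j : ℕ) : ℂ) = 0 := by rw [Nat.cast_sub (by omega)]; linear_combination -h0
        have : N - j = 0 := by exact_mod_cast this
        omega
      · refine poch_ne_zero.mpr fun j hj h0 => hγ (j + 1) (by omega) (by omega) ?_
        push_cast; linear_combination h0
      · refine poch_ne_zero.mpr fun j hj h0 => ?_
        -- Factor j of (-δ-N)_n is the negative of factor N-1-j of (δ+1)_N.
        refine poch_ne_zero.mp hδ (N - 1 - j) (by omega) ?_
        rw [Nat.cast_sub (by omega), Nat.cast_sub (by omega)]
        push_cast; linear_combination -h0
    · obtain ⟨j, rfl⟩ : ∃ j, n = N + 1 + j := ⟨n - N - 1, by omega⟩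
      rw [hsum0 _ _ (by omega), zero_add,
        hint _ _ _ _ (hasLatDiff_dualHahn_of_lt γ δ N j) (hasLatDiff_dualHahn_of_lt γ δ N j),
        smul_mul_smul_comm, map_smul, functional_hahnFamily_sq hmom, smul_eq_mul]
      have hd : ((N + 1 + j).descFactorial (N + 1) : ℂ) ≠ 0 := by
        have := (Nat.descFactorial_eq_zero_iff_lt (n := N + 1 + j) (k := N + 1)).not.mpr (by omega)
        exact_mod_cast this
      have hpi : (Real.pi : ℂ) ≠ 0 := by exact_mod_cast Real.pi_ne_zero
      refine mul_ne_zero (mul_ne_zero hd hd) (mul_ne_zero (mul_ne_zero (mul_ne_zero (mul_ne_zero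
        (mul_ne_zero (mul_ne_zero (mul_ne_zero (by norm_num) hpi) Complex.I_ne_zero)
        (mul_ne_zero (Complex.Gamma_ne_zero hu) (Complex.Gamma_ne_zero hv))) ?_) ?_) ?_) (hfac j))
      · exact poch_ne_zero.mpr fun i _ h0 => hu i (eq_neg_of_add_eq_zero_left h0)
      · rw [poch_one]; exact hfac j
      · exact poch_ne_zero.mpr fun i _ h0 => hv i (eq_neg_of_add_eq_zero_left h0)
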